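/- Let $0<\alpha\le 2$ and let $X=(X_t)_{t\ge 0}$ be the rotationally invariant (symmetric) $\alpha$-stable Lévy process on $\mathbb{R}$, with $\mathbb{P}^x$ the probability under which $X$ starts at $x$, normalized by $\mathbb{E}^x\big[e^{i\xi (X_t-x)}\big]=e^{-t|\xi|^\alpha}$ for $t\ge 0$, $x,\xi\in\mathbb{R}$. Let $\Omega=(a,b)$ with $-\infty<a<b<\infty$, $|\Omega|=b-a$, and put $$\mathbb{H}^{(\alpha)}_{\Omega,\Omega^c}(t)=\int_\Omega \mathbb{P}^x(X_t\in\Omega^c)\,dx .$$ In the following, each $C>0$ depends only on $\alpha$ and $\Omega$, and $[x]$ is the integer part of $x$. (i) If $1<\alpha\le 2$, then for all $t>0$ $$\mathbb{H}^{(\alpha)}_{\Omega,\Omega^c}(t)=\frac{2}{\pi}\Gamma\Big(1-\frac1\alpha\Big)t^{1/\alpha}+R_\alpha(t),\qquad |R_\alpha(t)|\le C\big(t\,\mathbf 1_{(1,2)}(\alpha)+t^{3/2}\,\mathbf 1_{\{2\}}(\alpha)\big).$$ (ii) If $\alpha=1$, then for all $t>0$ $$\mathbb{H}^{(1)}_{\Omega,\Omega^c}(t)=\frac2\pi\,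 t\ln\frac1t+\frac2\pi\Big(|\Omega|\arctan\frac{t}{|\Omega|}+\frac12\, t\ln\big(t^2+|\Omega|^2\big)\Big).$$ (iii) If $0<\alpha<1$ and $1/\alpha\notin\mathbb{N}$, there is a constant $C_\alpha$ depending only on $\alpha$ (not on $\Omega$) such that for all $0<t<\min\{|\Omega|^\alpha,e^{-1}\}$ $$\mathbb{H}^{(\alpha)}_{\Omega,\Omega^c}(t)=\frac2\pi\sum_{n=1}^{[1/\alpha]}(-1)^{n-1}\frac{\Gamma(n\alpha)}{(1-n\alpha)\,n!}|\Omega|^{1-n\alpha}\sin\Big(\frac{\pi n\alpha}{2}\Big)t^n+C_\alpha t^{1/\alpha}+R_\alpha(t),\qquad |R_\alpha(t)|\le C\,t^{[1/\alpha]+1}.$$ (iv) If $\alpha=1/N$ for an integer $N\ge2$, there is a constant $C_N(\Omega)$ depending only on $N$ and $\Omega$ such that for all $0<t<\min\{|\Omega|^{1/N},e^{-1}\}$ $$\mathbb{H}^{(1/N)}_{\Omega,\Omega^c}(t)=\frac2\pi\sum_{n=1}^{N-1}(-1)^{n-1}\frac{\Gamma(n/N)}{(1-n/N)\,n!}|\Omega|^{1-n/N}\sin\Big(\frac{\pi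 n}{2N}\Big)t^n+(-1)^{N-1}\frac{2}{\pi (N-1)!}\,t^N\ln\frac1t+C_N(\Omega)\,t^N+R_{1/N}(t),$$ with $|R_{1/N}(t)|\le C\,t^{N+1}$. -/

import Mathlib

open MeasureTheory ProbabilityTheory
open scoped NNReal ENNReal

universe u

/-- A (rotationally invariant) `α`-stable Lévy process on the real line, together with the
probabilities `P x` under which it starts at `x`: its increments are independent, and the
increment over `[s, t]` has characteristic function `ξ ↦ exp (-(t - s) |ξ| ^ α)`. In particular
the increments are stationary and the process is stochastically continuous. Neither the
underlying probability space nor the regularity of the sample paths is restricted. -/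
structure StableProcess (α : ℝ) where
  /-- The sample space. -/
  Sample : Type u
  /-- The events. -/
  [mSample : MeasurableSpace Sample]
  /-- The state `X t ω` at time `t`. -/
  X : ℝ≥0 → Sample → ℝ
  /-- The probability `P x` of the process started at `x`. -/
  P : ℝ → Measure Sample
  isProbabilityMeasure_P : ∀ x, IsProbabilityMeasure (P x)
  measurable_X : ∀ t, Measurable (X t)
  start : ∀ x, ∀ᵐ ω ∂P x, X 0 ω = x
  indepIncrements : ∀ x, HasIndepIncrements X (P x)
  charFun_increment : ∀ x s t, s ≤ t → ∀ ξ : ℝ,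
    charFun ((P x).map (X t - X s)) ξ = ((Real.exp (-((t : ℝ) - s) * |ξ| ^ α) : ℝ) : ℂ)

/-- The quantity `ℍ_{A, B}(t) = ∫_A Pˣ(X_t ∈ B) dx`. -/
noncomputable def StableProcess.heat {α : ℝ} (Y : StableProcess.{u} α) (A B : Set ℝ)
    (t : ℝ≥0) : ℝ≥0∞ :=
  letI := Y.mSample
  ∫⁻ x in A, Y.P x {ω | Y.X t ω ∈ B}

/-!
By translation invariance the heat loss of an interval of length `L` at time `t` is
`E min(|X_t - X_0|, L)`. Since
`min(|y|, L) = (2 / π) ∫_0^∞ (1 - cos (L u)) (1 - cos (y u)) / u ^ 2 du`,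
averaging in `y` and scaling turn it into `(2 / π) t ^ (1 / α) F (L t ^ (-1 / α))`, where
`F c = ∫_0^∞ (1 - cos (c u)) (1 - exp (-u ^ α)) / u ^ 2 du`.
Small times thus correspond to large `c`. Each Taylor term of `exp (-u ^ α)` whose moment against
`(1 - cos (c u)) / u ^ 2` converges contributes a multiple of `c ^ (1 - n α)`. If `1 / α` is not an
integer, the remaining kernel is integrable: its integral is `Γ(1 - 1 / α)`, by the
Cauchy–Saalschütz formula, and its cosine transform decays, as integration by parts shows. If
`1 / α` is an integer, the remaining kernel has a simple pole at `0`; subtracting the same multiple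
of `exp (-u) / u`, whose transform is `log (1 + c ^ 2) / 2`, restores integrability and accounts for
the logarithm. For `α = 1` the function `F` is elementary. For `α = 2` the increments are Gaussian,
with finite third moment, which gives the better remainder.
-/

section

open Real Set Filter Topology

lemma integrable_prod_of_nonneg {α β : Type*} [MeasurableSpace α] [MeasurableSpace β]
    {μ : Measure α} {ν : Measure β} [SFinite ν] {f : α × β → ℝ}
    (hf : AEStronglyMeasurable f (μ.prod ν)) (hf0 : ∀ᵐ x ∂μ, ∀ᵐ y ∂ν, 0 ≤ f (x, y))
    (hfν : ∀ᵐ x ∂μ, Integrable (fun y => f (x, y)) ν)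
    (hfμ : Integrable (fun x => ∫ y, f (x, y) ∂ν) μ) : Integrable f (μ.prod ν) := by
  refine (integrable_prod_iff hf).2 ⟨hfν, hfμ.congr ?_⟩
  filter_upwards [hf0] with x hx
  exact integral_congr_ae (hx.mono fun y hy => (norm_of_nonneg hy).symm)

lemma one_sub_cos_mul_exp_eq_re (c v u : ℝ) :
    (1 - cos (c * u)) * exp (-v * u)
      = (Complex.exp ((-v : ℂ) * u) - Complex.exp ((-v + c * Complex.I) * u)).re := by
  simp [Complex.exp_re]
  ring

lemma integrableOn_one_sub_cos_mul_exp (c : ℝ) {v : ℝ} (hv : 0 < v) :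
    IntegrableOn (fun u => (1 - cos (c * u)) * exp (-v * u)) (Ioi 0) := by
  simp_rw [one_sub_cos_mul_exp_eq_re]
  exact ((integrableOn_exp_mul_complex_Ioi (by simpa) 0).sub
    (integrableOn_exp_mul_complex_Ioi (by simpa) 0)).re

lemma integral_one_sub_cos_mul_exp (c : ℝ) {v : ℝ} (hv : 0 < v) :
    ∫ u in Ioi (0 : ℝ), (1 - cos (c * u)) * exp (-v * u) = c ^ 2 / (v * (v ^ 2 + c ^ 2)) := by
  have hexp := integrableOn_exp_mul_complex_Ioi (a := -v) (by simpa) 0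
  have hosc := integrableOn_exp_mul_complex_Ioi (a := -v + c * Complex.I) (by simpa) 0
  simp_rw [one_sub_cos_mul_exp_eq_re]
  refine (integral_re (𝕜 := ℂ) (hexp.sub hosc)).trans ?_
  simp only [Pi.sub_apply]
  rw [integral_sub hexp hosc,
    integral_exp_mul_complex_Ioi (by simpa), integral_exp_mul_complex_Ioi (by simpa)]
  simp [Complex.div_re, Complex.normSq_apply]
  field_simp
  ring

section LaplaceWeight

variable (c : ℝ) {μ : Measure ℝ} {w : ℝ → ℝ}

lemma integrable_one_sub_cos_mul_exp_mul_weight (hμ : ∀ᵐ v ∂μ, 0 < v) (hwm : Measurable w)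
    (hw : ∀ᵐ v ∂μ, 0 ≤ w v)
    (h_int : Integrable (fun v => w v * (c ^ 2 / (v * (v ^ 2 + c ^ 2)))) μ) :
    Integrable (fun p : ℝ × ℝ => w p.1 * ((1 - cos (c * p.2)) * exp (-p.1 * p.2)))
      (μ.prod (volume.restrict (Ioi 0))) := by
  refine integrable_prod_of_nonneg (by fun_prop) ?_ ?_ (h_int.congr ?_)
  · filter_upwards [hw] with v hv
    refine Eventually.of_forall fun u => ?_
    have := sub_nonneg.2 (cos_le_one (c * u))
    positivity
  · filter_upwards [hμ] with v hv
    exact (integrableOn_one_sub_cos_mul_exp c hv).const_mul (w v)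
  · filter_upwards [hμ] with v hv
    rw [integral_const_mul, integral_one_sub_cos_mul_exp c hv]

lemma integrableOn_one_sub_cos_mul_laplace [SFinite μ] (hμ : ∀ᵐ v ∂μ, 0 < v) (hwm : Measurable w)
    (hw : ∀ᵐ v ∂μ, 0 ≤ w v)
    (h_int : Integrable (fun v => w v * (c ^ 2 / (v * (v ^ 2 + c ^ 2)))) μ) :
    IntegrableOn (fun u => (1 - cos (c * u)) * ∫ v, w v * exp (-v * u) ∂μ) (Ioi 0) := by
  refine (integrable_one_sub_cos_mul_exp_mul_weight c hμ hwm hw h_int).integral_prod_right.congr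
    (Eventually.of_forall fun u => ?_)
  simp only [mul_left_comm (w _), integral_const_mul]

lemma integral_one_sub_cos_mul_laplace [SFinite μ] (hμ : ∀ᵐ v ∂μ, 0 < v) (hwm : Measurable w)
    (hw : ∀ᵐ v ∂μ, 0 ≤ w v)
    (h_int : Integrable (fun v => w v * (c ^ 2 / (v * (v ^ 2 + c ^ 2)))) μ) :
    ∫ u in Ioi (0 : ℝ), (1 - cos (c * u)) * ∫ v, w v * exp (-v * u) ∂μ
      = ∫ v, w v * (c ^ 2 / (v * (v ^ 2 + c ^ 2))) ∂μ := by
  calc ∫ u in Ioi (0 : ℝ), (1 - cos (c * u)) * ∫ v, w v * exp (-v * u) ∂μ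
      = ∫ u in Ioi (0 : ℝ), ∫ v, w v * ((1 - cos (c * u)) * exp (-v * u)) ∂μ := by
        simp only [mul_left_comm (w _), integral_const_mul]
    _ = ∫ v, (∫ u in Ioi (0 : ℝ), w v * ((1 - cos (c * u)) * exp (-v * u))) ∂μ :=
        (integral_integral_swap
          (integrable_one_sub_cos_mul_exp_mul_weight c hμ hwm hw h_int)).symm
    _ = _ := integral_congr_ae <| hμ.mono fun v hv => by
        simp only [integral_const_mul, integral_one_sub_cos_mul_exp c hv]

end LaplaceWeight

section PowerMoments

variable {β r : ℝ}

lemma integral_rpow_mul_exp_neg_mul_sq (hβ : β < 1) {y : ℝ} (hy : 0 < y) :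
    ∫ v in Ioi (0 : ℝ), v ^ (-β) * exp (-y * v ^ (2 : ℝ))
      = 1 / 2 * Gamma ((1 - β) / 2) * y ^ ((1 + β) / 2 - 1) := by
  rw [integral_rpow_mul_exp_neg_mul_rpow two_pos (by linarith) hy]
  ring_nf

lemma integrable_rpow_mul_exp_neg_mul_sq_add (h1 : -1 < β) (h2 : β < 1) (hr : 0 < r) :
    Integrable (fun p : ℝ × ℝ => exp (-r * p.1) * (p.2 ^ (-β) * exp (-p.1 * p.2 ^ (2 : ℝ))))
      ((volume.restrict (Ioi 0)).prod (volume.restrict (Ioi 0))) := by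
  refine integrable_prod_of_nonneg (by fun_prop) ?_ ?_ ?_
  · filter_upwards with y
    filter_upwards [ae_restrict_mem measurableSet_Ioi] with v (hv : 0 < v)
    positivity
  · filter_upwards [ae_restrict_mem measurableSet_Ioi] with y (hy : 0 < y)
    exact (integrableOn_rpow_mul_exp_neg_mul_rpow (by linarith) two_pos hy).const_mul _
  · have hGamma : IntegrableOn (fun y : ℝ => y ^ ((1 + β) / 2 - 1) * exp (-r * y ^ (1 : ℝ)))
        (Ioi 0) := integrableOn_rpow_mul_exp_neg_mul_rpow (by linarith) one_pos hr
    refine (integrableOn_congr_fun (fun y (hy : 0 < y) => ?_) measurableSet_Ioi).2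
      (hGamma.const_mul (1 / 2 * Gamma ((1 - β) / 2)))
    simp only [integral_const_mul, integral_rpow_mul_exp_neg_mul_sq h2 hy, rpow_one]
    ring

lemma integral_exp_neg_mul_mul_rpow_mul_exp {v : ℝ} (hv : 0 < v ^ 2 + r) :
    ∫ y in Ioi (0 : ℝ), exp (-r * y) * (v ^ (-β) * exp (-y * v ^ (2 : ℝ)))
      = v ^ (-β) / (v ^ 2 + r) := by
  have (y : ℝ) : exp (-r * y) * (v ^ (-β) * exp (-y * v ^ (2 : ℝ)))
      = v ^ (-β) * exp (-(v ^ 2 + r) * y) := by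
    rw [mul_left_comm, ← exp_add, rpow_two]
    ring_nf
  simp_rw [this]
  rw [integral_const_mul, integral_exp_mul_Ioi (by linarith)]
  simp [div_eq_mul_inv, ← inv_neg]

lemma integrableOn_rpow_neg_div_sq_add (h1 : -1 < β) (h2 : β < 1) (hr : 0 < r) :
    IntegrableOn (fun v : ℝ => v ^ (-β) / (v ^ 2 + r)) (Ioi 0) :=
  (integrable_rpow_mul_exp_neg_mul_sq_add h1 h2 hr).integral_prod_right.congr <|
    Eventually.of_forall fun _ => integral_exp_neg_mul_mul_rpow_mul_exp (by positivity)

lemma Gamma_mul_Gamma_eq_pi_div_cos (β : ℝ) :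
    Gamma ((1 - β) / 2) * Gamma ((1 + β) / 2) = π / cos (π * β / 2) := by
  rw [show (1 + β) / 2 = 1 - (1 - β) / 2 by ring, Gamma_mul_Gamma_one_sub,
    show π * ((1 - β) / 2) = π / 2 - π * β / 2 by ring, sin_pi_div_two_sub]

lemma integral_rpow_neg_div_sq_add (h1 : -1 < β) (h2 : β < 1) (hr : 0 < r) :
    ∫ v in Ioi (0 : ℝ), v ^ (-β) / (v ^ 2 + r)
      = π / (2 * cos (π * β / 2)) * r ^ (-((1 + β) / 2)) := by
  calc ∫ v in Ioi (0 : ℝ), v ^ (-β) / (v ^ 2 + r)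
      = ∫ v in Ioi (0 : ℝ), ∫ y in Ioi (0 : ℝ),
          exp (-r * y) * (v ^ (-β) * exp (-y * v ^ (2 : ℝ))) :=
        integral_congr_ae <| Eventually.of_forall fun v =>
          (integral_exp_neg_mul_mul_rpow_mul_exp (by positivity)).symm
    _ = ∫ y in Ioi (0 : ℝ), ∫ v in Ioi (0 : ℝ),
          exp (-r * y) * (v ^ (-β) * exp (-y * v ^ (2 : ℝ))) :=
        (integral_integral_swap (integrable_rpow_mul_exp_neg_mul_sq_add h1 h2 hr)).symm
    _ = ∫ y in Ioi (0 : ℝ), 1 / 2 * Gamma ((1 - β) / 2) *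
          (y ^ ((1 + β) / 2 - 1) * exp (-(r * y))) :=
        setIntegral_congr_fun measurableSet_Ioi fun y (hy : 0 < y) => by
          rw [integral_const_mul, integral_rpow_mul_exp_neg_mul_sq h2 hy, neg_mul]
          ring
    _ = π / (2 * cos (π * β / 2)) * r ^ (-((1 + β) / 2)) := by
        rw [integral_const_mul, integral_rpow_mul_exp_neg_mul_Ioi (by linarith) hr, one_div r,
          inv_rpow hr.le, ← rpow_neg hr.le]
        linear_combination 1 / 2 * r ^ (-((1 + β) / 2)) * Gamma_mul_Gamma_eq_pi_div_cos β

lemma integral_rpow_mul_exp_neg_mul (hβ : β < 2) {u : ℝ} (hu : 0 < u) :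
    ∫ v in Ioi (0 : ℝ), v ^ (1 - β) * exp (-v * u) = u ^ (β - 2) * Gamma (2 - β) := by
  have := integral_rpow_mul_exp_neg_mul_Ioi (a := 2 - β) (by linarith) hu
  rw [one_div, inv_rpow hu.le, ← rpow_neg hu.le, neg_sub] at this
  rw [← this]
  ring_nf
  simp only [mul_comm u]

lemma rpow_mul_sq_div_mul_sq_add_sq {c v : ℝ} (hv : 0 < v) :
    v ^ (1 - β) * (c ^ 2 / (v * (v ^ 2 + c ^ 2))) = c ^ 2 * (v ^ (-β) / (v ^ 2 + c ^ 2)) := by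
  rw [sub_eq_neg_add, rpow_add_one hv.ne']
  field_simp

lemma integrableOn_rpow_mul_sq_div_mul_sq_add_sq (h1 : -1 < β) (h2 : β < 1) {c : ℝ} (hc : 0 < c) :
    IntegrableOn (fun v : ℝ => v ^ (1 - β) * (c ^ 2 / (v * (v ^ 2 + c ^ 2)))) (Ioi 0) :=
  (integrableOn_congr_fun (fun _ hv => rpow_mul_sq_div_mul_sq_add_sq hv) measurableSet_Ioi).2
    ((integrableOn_rpow_neg_div_sq_add h1 h2 (sq_pos_of_pos hc)).const_mul _)

lemma integrableOn_one_sub_cos_mul_rpow (h1 : -1 < β) (h2 : β < 1) {c : ℝ} (hc : 0 < c) :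
    IntegrableOn (fun u : ℝ => (1 - cos (c * u)) * u ^ (β - 2)) (Ioi 0) := by
  have hΓ : Gamma (2 - β) ≠ 0 := (Gamma_pos_of_pos (by linarith)).ne'
  have hpos := ae_restrict_mem (μ := volume) (measurableSet_Ioi (a := (0 : ℝ)))
  have hlaplace := integrableOn_one_sub_cos_mul_laplace c (w := fun v => v ^ (1 - β)) hpos
    (by fun_prop) (hpos.mono fun v hv => rpow_nonneg (le_of_lt hv) _)
    (integrableOn_rpow_mul_sq_div_mul_sq_add_sq h1 h2 hc)
  refine (integrableOn_congr_fun (fun u hu => ?_) measurableSet_Ioi).1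
    (hlaplace.mul_const (Gamma (2 - β))⁻¹)
  rw [integral_rpow_mul_exp_neg_mul (by linarith) hu]
  field_simp

lemma integral_one_sub_cos_mul_rpow (h1 : -1 < β) (h2 : β < 1) {c : ℝ} (hc : 0 < c) :
    (∫ u in Ioi (0 : ℝ), (1 - cos (c * u)) * u ^ (β - 2)) * Gamma (2 - β)
      = π / (2 * cos (π * β / 2)) * c ^ (1 - β) := by
  have hpos := ae_restrict_mem (μ := volume) (measurableSet_Ioi (a := (0 : ℝ)))
  calc (∫ u in Ioi (0 : ℝ), (1 - cos (c * u)) * u ^ (β - 2)) * Gamma (2 - β)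
      = ∫ u in Ioi (0 : ℝ), (1 - cos (c * u)) * ∫ v in Ioi (0 : ℝ), v ^ (1 - β) * exp (-v * u) := by
        rw [← integral_mul_const]
        refine setIntegral_congr_fun measurableSet_Ioi fun u hu => ?_
        rw [integral_rpow_mul_exp_neg_mul (by linarith) hu, mul_assoc]
    _ = ∫ v in Ioi (0 : ℝ), v ^ (1 - β) * (c ^ 2 / (v * (v ^ 2 + c ^ 2))) :=
        integral_one_sub_cos_mul_laplace c hpos (by fun_prop)
          (hpos.mono fun v hv => rpow_nonneg (le_of_lt hv) _)
          (integrableOn_rpow_mul_sq_div_mul_sq_add_sq h1 h2 hc)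
    _ = ∫ v in Ioi (0 : ℝ), c ^ 2 * (v ^ (-β) / (v ^ 2 + c ^ 2)) :=
        setIntegral_congr_fun measurableSet_Ioi fun _ hv => rpow_mul_sq_div_mul_sq_add_sq hv
    _ = π / (2 * cos (π * β / 2)) * c ^ (1 - β) := by
        rw [integral_const_mul, integral_rpow_neg_div_sq_add h1 h2 (sq_pos_of_pos hc),
          mul_left_comm,
          ← rpow_two, ← rpow_mul hc.le, ← rpow_add hc]
        ring_nf

lemma integral_one_sub_cos_mul_rpow_eq_sin (h1 : 0 < β) (h2 : β < 1) {c : ℝ} (hc : 0 < c) :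
    ∫ u in Ioi (0 : ℝ), (1 - cos (c * u)) * u ^ (β - 2)
      = Gamma β / (1 - β) * sin (π * β / 2) * c ^ (1 - β) := by
  have hlt : π * β / 2 < π / 2 := by nlinarith [pi_pos]
  have hsin : sin (π * β / 2) ≠ 0 :=
    (sin_pos_of_pos_of_lt_pi (by positivity) (by linarith [pi_pos])).ne'
  have hcos : cos (π * β / 2) ≠ 0 :=
    (cos_pos_of_mem_Ioo ⟨by linarith [mul_pos pi_pos h1], hlt⟩).ne'
  have hΓ : Gamma (1 - β) ≠ 0 := (Gamma_pos_of_pos (by linarith)).ne'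
  have hβ : 1 - β ≠ 0 := by linarith
  have hreflection := Gamma_mul_Gamma_one_sub β
  rw [show π * β = 2 * (π * β / 2) by ring, sin_two_mul, eq_div_iff (by positivity)] at hreflection
  have hmoment := integral_one_sub_cos_mul_rpow (by linarith) h2 hc
  rw [show 2 - β = (1 - β) + 1 by ring, Gamma_add_one hβ] at hmoment
  refine mul_right_cancel₀ (mul_ne_zero hβ hΓ) (hmoment.trans ?_)
  field_simp
  linear_combination - hreflection

lemma one_sub_cos_mul_div_sq_eq (c : ℝ) {u : ℝ} (hu : 0 < u) :
    (1 - cos (c * u)) / u ^ 2 = (1 - cos (|c| * u)) * u ^ ((0 : ℝ) - 2) := by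
  rw [zero_sub, rpow_neg hu.le, rpow_two, div_eq_mul_inv, ← cos_abs (c * u), abs_mul,
    abs_of_pos hu]

lemma integrableOn_one_sub_cos_div_sq (c : ℝ) :
    IntegrableOn (fun u : ℝ => (1 - cos (c * u)) / u ^ 2) (Ioi 0) := by
  rcases eq_or_ne c 0 with rfl | hc
  · simp
  · exact (integrableOn_congr_fun (fun u hu => one_sub_cos_mul_div_sq_eq c hu) measurableSet_Ioi).2
      (integrableOn_one_sub_cos_mul_rpow (by norm_num) one_pos (abs_pos.2 hc))

lemma integral_one_sub_cos_div_sq (c : ℝ) :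
    ∫ u in Ioi (0 : ℝ), (1 - cos (c * u)) / u ^ 2 = π / 2 * |c| := by
  rcases eq_or_ne c 0 with rfl | hc
  · simp
  · have := integral_one_sub_cos_mul_rpow (β := 0) (by norm_num) one_pos (abs_pos.2 hc)
    rw [setIntegral_congr_fun measurableSet_Ioi fun u hu => one_sub_cos_mul_div_sq_eq c hu]
    simpa using this

lemma abs_add_abs_sub_half_abs_add_sub_half_abs_sub (y : ℝ) {L : ℝ} (hL : 0 ≤ L) :
    L + |y| - 1 / 2 * |L + y| - 1 / 2 * |L - y| = min |y| L := by
  grind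

lemma integral_one_sub_cos_mul_one_sub_cos_div_sq (y : ℝ) {L : ℝ} (hL : 0 ≤ L) :
    ∫ u in Ioi (0 : ℝ), (1 - cos (L * u)) / u ^ 2 * (1 - cos (y * u)) = π / 2 * min |y| L := by
  have hprod (u : ℝ) : (1 - cos (L * u)) / u ^ 2 * (1 - cos (y * u))
      = (1 - cos (L * u)) / u ^ 2 + (1 - cos (y * u)) / u ^ 2
        - 1 / 2 * ((1 - cos ((L + y) * u)) / u ^ 2)
        - 1 / 2 * ((1 - cos ((L - y) * u)) / u ^ 2) := by
    rw [add_mul L, sub_mul L, cos_add, cos_sub]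
    ring
  have h_int := integrableOn_one_sub_cos_div_sq
  simp_rw [hprod]
  rw [integral_sub, integral_sub, integral_add (h_int L) (h_int y), integral_const_mul,
    integral_const_mul]
  · simp only [integral_one_sub_cos_div_sq, abs_of_nonneg hL,
      ← abs_add_abs_sub_half_abs_add_sub_half_abs_sub y hL]
    ring
  · exact (h_int L).add (h_int y)
  · exact (h_int (L + y)).const_mul _
  · exact ((h_int L).add (h_int y)).sub ((h_int (L + y)).const_mul _)
  · exact (h_int (L - y)).const_mul _

end PowerMoments

section ExponentialMoments

lemma hasDerivAt_neg_half_log_one_add_div_sq (c : ℝ) {v : ℝ} (hv : 0 < v) :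
    HasDerivAt (fun v => -(1 / 2 * log (1 + c ^ 2 / v ^ 2))) (c ^ 2 / (v * (v ^ 2 + c ^ 2))) v := by
  have hinner :
      HasDerivAt (fun v : ℝ => 1 + c ^ 2 / v ^ 2) (-(c ^ 2 * (2 * v)) / (v ^ 2) ^ 2) v := by
    simpa using ((hasDerivAt_const v (c ^ 2)).div (hasDerivAt_pow 2 v) (by positivity)).const_add 1
  refine ((hinner.log (by positivity)).const_mul (1 / 2)).fun_neg.congr_deriv ?_
  field_simp

lemma tendsto_neg_half_log_one_add_div_sq (c : ℝ) :
    Tendsto (fun v : ℝ => -(1 / 2 * log (1 + c ^ 2 / v ^ 2))) atTop (𝓝 0) := by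
  have hinner : Tendsto (fun v : ℝ => 1 + c ^ 2 / v ^ 2) atTop (𝓝 (1 + 0)) :=
    (tendsto_const_nhds.div_atTop (tendsto_pow_atTop two_ne_zero)).const_add 1
  simpa only [add_zero, log_one, mul_zero, neg_zero] using
    ((hinner.log (by norm_num)).const_mul (1 / 2)).neg

lemma integrableOn_Ioi_one_sq_div_mul_sq_add_sq (c : ℝ) :
    IntegrableOn (fun v : ℝ => c ^ 2 / (v * (v ^ 2 + c ^ 2))) (Ioi 1) :=
  integrableOn_Ioi_deriv_of_nonneg'
    (fun _ hv => hasDerivAt_neg_half_log_one_add_div_sq c (one_pos.trans_le hv))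
    (fun v (hv : 1 < v) => by positivity) (tendsto_neg_half_log_one_add_div_sq c)

lemma integral_Ioi_one_sq_div_mul_sq_add_sq (c : ℝ) :
    ∫ v in Ioi (1 : ℝ), c ^ 2 / (v * (v ^ 2 + c ^ 2)) = 1 / 2 * log (1 + c ^ 2) := by
  rw [integral_Ioi_of_hasDerivAt_of_nonneg'
    (fun _ hv => hasDerivAt_neg_half_log_one_add_div_sq c (one_pos.trans_le hv))
    (fun v (hv : 1 < v) => by positivity) (tendsto_neg_half_log_one_add_div_sq c)]
  simp

lemma integral_Ioi_one_exp_neg_mul {u : ℝ} (hu : 0 < u) :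
    ∫ v in Ioi (1 : ℝ), exp (-v * u) = exp (-u) / u := by
  have := integral_exp_mul_Ioi (neg_lt_zero.2 hu) 1
  rw [mul_one, neg_div_neg_eq] at this
  simp_rw [← this, neg_mul, mul_comm]

lemma ae_restrict_Ioi_one_pos : ∀ᵐ v : ℝ ∂volume.restrict (Ioi 1), 0 < v :=
  (ae_restrict_mem measurableSet_Ioi).mono fun _ hv => one_pos.trans hv

lemma integrableOn_one_sub_cos_mul_exp_neg_div (c : ℝ) :
    IntegrableOn (fun u => (1 - cos (c * u)) * (exp (-u) / u)) (Ioi 0) := by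
  have := integrableOn_one_sub_cos_mul_laplace c (w := 1) ae_restrict_Ioi_one_pos
    measurable_one (Eventually.of_forall fun _ => zero_le_one)
    (by simpa using (integrableOn_Ioi_one_sq_div_mul_sq_add_sq c).integrable)
  refine (integrableOn_congr_fun (fun u hu => ?_) measurableSet_Ioi).1 this
  simp only [Pi.one_apply, one_mul, integral_Ioi_one_exp_neg_mul hu]

lemma integral_one_sub_cos_mul_exp_neg_div (c : ℝ) :
    ∫ u in Ioi (0 : ℝ), (1 - cos (c * u)) * (exp (-u) / u) = 1 / 2 * log (1 + c ^ 2) := by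
  have := integral_one_sub_cos_mul_laplace c (w := 1) ae_restrict_Ioi_one_pos
    measurable_one (Eventually.of_forall fun _ => zero_le_one)
    (by simpa using (integrableOn_Ioi_one_sq_div_mul_sq_add_sq c).integrable)
  simp only [Pi.one_apply, one_mul, integral_Ioi_one_sq_div_mul_sq_add_sq] at this
  rw [← this]
  exact setIntegral_congr_fun measurableSet_Ioi fun u hu => by
    simp only [integral_Ioi_one_exp_neg_mul hu]

lemma integral_Ioc_mul_exp_neg_mul {u : ℝ} (hu : u ≠ 0) :
    ∫ v in Ioc (0 : ℝ) 1, v * exp (-v * u) = (1 - exp (-u) * (1 + u)) / u ^ 2 := by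
  have hderiv (v : ℝ) : HasDerivAt (fun v => -(exp (-v * u) * (v / u + 1 / u ^ 2)))
      (v * exp (-v * u)) v := by
    have hexp : HasDerivAt (fun v => exp (-v * u)) (exp (-v * u) * (-1 * u)) v :=
      ((hasDerivAt_neg v).mul_const u).exp
    refine (hexp.mul (((hasDerivAt_id v).div_const u).add_const (1 / u ^ 2))).fun_neg.congr_deriv ?_
    simp only [id]
    field_simp
    ring
  rw [← intervalIntegral.integral_of_le zero_le_one,
    intervalIntegral.integral_eq_sub_of_hasDerivAt (fun v _ => hderiv v)
      ((by fun_prop : Continuous fun v => v * exp (-v * u)).intervalIntegrable _ _)]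
  simp
  field_simp
  ring

lemma integral_Ioc_sq_div_sq_add_sq {c : ℝ} (hc : c ≠ 0) :
    ∫ v in Ioc (0 : ℝ) 1, c ^ 2 / (v ^ 2 + c ^ 2) = c * arctan (1 / c) := by
  rw [← intervalIntegral.integral_of_le zero_le_one,
    intervalIntegral.integral_eq_sub_of_hasDerivAt (f := fun v => c * arctan (v / c))]
  · simp
  · intro v _
    refine (((hasDerivAt_id v).div_const c).arctan.const_mul c).congr_deriv ?_
    simp only [id]
    field_simp
    ring
  · exact (continuous_const.div (by fun_prop) fun v => by positivity).intervalIntegrable _ _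

lemma mul_sq_div_mul_sq_add_sq (c : ℝ) {v : ℝ} (hv : v ≠ 0) :
    v * (c ^ 2 / (v * (v ^ 2 + c ^ 2))) = c ^ 2 / (v ^ 2 + c ^ 2) := by
  field_simp

lemma integrableOn_Ioc_mul_sq_div_mul_sq_add_sq {c : ℝ} (hc : c ≠ 0) :
    IntegrableOn (fun v : ℝ => v * (c ^ 2 / (v * (v ^ 2 + c ^ 2)))) (Ioc 0 1) :=
  (integrableOn_congr_fun (fun _ hv => mul_sq_div_mul_sq_add_sq c hv.1.ne') measurableSet_Ioc).2
    (continuous_const.div (by fun_prop) fun v => by positivity).integrableOn_Ioc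

lemma integrableOn_one_sub_cos_mul_one_sub_exp_neg_mul_one_add_div_sq {c : ℝ} (hc : c ≠ 0) :
    IntegrableOn (fun u => (1 - cos (c * u)) * ((1 - exp (-u) * (1 + u)) / u ^ 2)) (Ioi 0) := by
  have hpos := ae_restrict_mem (μ := volume) (measurableSet_Ioc (a := (0 : ℝ)) (b := 1))
  have := integrableOn_one_sub_cos_mul_laplace c (w := id) (hpos.mono fun _ hv => hv.1)
    measurable_id (hpos.mono fun _ hv => hv.1.le) (integrableOn_Ioc_mul_sq_div_mul_sq_add_sq hc)
  refine (integrableOn_congr_fun (fun u (hu : 0 < u) => ?_) measurableSet_Ioi).1 this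
  simp only [id, integral_Ioc_mul_exp_neg_mul hu.ne']

lemma integral_one_sub_cos_mul_one_sub_exp_neg_mul_one_add_div_sq {c : ℝ} (hc : c ≠ 0) :
    ∫ u in Ioi (0 : ℝ), (1 - cos (c * u)) * ((1 - exp (-u) * (1 + u)) / u ^ 2)
      = c * arctan (1 / c) := by
  have hpos := ae_restrict_mem (μ := volume) (measurableSet_Ioc (a := (0 : ℝ)) (b := 1))
  have hlaplace := integral_one_sub_cos_mul_laplace c (w := id) (hpos.mono fun _ hv => hv.1)
    measurable_id (hpos.mono fun _ hv => hv.1.le) (integrableOn_Ioc_mul_sq_div_mul_sq_add_sq hc)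
  rw [← integral_Ioc_sq_div_sq_add_sq hc, ← setIntegral_congr_fun measurableSet_Ioc
    fun v hv => mul_sq_div_mul_sq_add_sq c hv.1.ne']
  refine (setIntegral_congr_fun measurableSet_Ioi fun u (hu : 0 < u) => ?_).trans hlaplace
  simp only [id, integral_Ioc_mul_exp_neg_mul hu.ne']

lemma integral_one_sub_cos_mul_one_sub_exp_neg_div_sq {c : ℝ} (hc : c ≠ 0) :
    ∫ u in Ioi (0 : ℝ), (1 - cos (c * u)) * ((1 - exp (-u)) / u ^ 2)
      = c * arctan (1 / c) + 1 / 2 * log (1 + c ^ 2) := by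
  rw [← integral_one_sub_cos_mul_one_sub_exp_neg_mul_one_add_div_sq hc,
    ← integral_one_sub_cos_mul_exp_neg_div, ← integral_add
      (integrableOn_one_sub_cos_mul_one_sub_exp_neg_mul_one_add_div_sq hc)
      (integrableOn_one_sub_cos_mul_exp_neg_div c)]
  refine setIntegral_congr_fun measurableSet_Ioi fun u (hu : 0 < u) => ?_
  field_simp
  ring

end ExponentialMoments

section TruncatedMean

variable {ν : Measure ℝ}

lemma integral_cos_mul_eq_re_charFun [IsFiniteMeasure ν] (u : ℝ) :
    ∫ y, cos (y * u) ∂ν = (charFun ν u).re := by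
  have h_int : Integrable (fun y : ℝ => Complex.exp (u * y * Complex.I)) ν := by
    refine (integrable_const (1 : ℝ)).mono' (by fun_prop) (Eventually.of_forall fun y => ?_)
    rw [← Complex.ofReal_mul, Complex.norm_exp_ofReal_mul_I]
  rw [charFun_apply_real]
  refine Eq.trans ?_ (integral_re (𝕜 := ℂ) h_int)
  simp_rw [← Complex.ofReal_mul, mul_comm u]
  exact integral_congr_ae (Eventually.of_forall fun y => (Complex.exp_ofReal_mul_I_re _).symm)

variable [IsProbabilityMeasure ν]

lemma integral_one_sub_cos_mul_eq_one_sub_re_charFun (u : ℝ) :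
    ∫ y, (1 - cos (y * u)) ∂ν = 1 - (charFun ν u).re := by
  have hcos : Integrable (fun y => cos (y * u)) ν :=
    (integrable_const (1 : ℝ)).mono' (by fun_prop)
      (Eventually.of_forall fun y => abs_cos_le_one _)
  rw [integral_sub (integrable_const _) hcos, integral_cos_mul_eq_re_charFun]
  simp

variable (ν) in
lemma integrable_one_sub_cos_div_sq_mul_one_sub_cos (L : ℝ) :
    Integrable (fun p : ℝ × ℝ => (1 - cos (L * p.2)) / p.2 ^ 2 * (1 - cos (p.1 * p.2)))
      (ν.prod (volume.restrict (Ioi 0))) := by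
  refine ((integrableOn_one_sub_cos_div_sq L).comp_snd ν).mul_bdd (c := 2) (by fun_prop) ?_
  refine Eventually.of_forall fun p => abs_le.2 ⟨?_, ?_⟩ <;>
    linarith [neg_one_le_cos (p.1 * p.2), cos_le_one (p.1 * p.2)]

lemma integral_min_abs_eq {L : ℝ} (hL : 0 ≤ L) :
    ∫ y, min |y| L ∂ν
      = 2 / π * ∫ u in Ioi (0 : ℝ), (1 - cos (L * u)) / u ^ 2 * (1 - (charFun ν u).re) := by
  have hswap : ∫ y, π / 2 * min |y| L ∂ν
      = ∫ u in Ioi (0 : ℝ), (1 - cos (L * u)) / u ^ 2 * (1 - (charFun ν u).re) := by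
    simp_rw [← integral_one_sub_cos_mul_one_sub_cos_div_sq _ hL]
    rw [integral_integral_swap (integrable_one_sub_cos_div_sq_mul_one_sub_cos ν L)]
    simp_rw [integral_const_mul, integral_one_sub_cos_mul_eq_one_sub_re_charFun]
  rw [← hswap, integral_const_mul]
  field_simp

end TruncatedMean

lemma volume_Ioo_inter_add_mem_compl {a b : ℝ} (hab : a < b) (y : ℝ) :
    volume (Ioo a b ∩ {x | x + y ∈ (Ioo a b)ᶜ}) = ENNReal.ofReal (min |y| (b - a)) := by
  have hsdiff : Ioo a b ∩ {x | x + y ∈ (Ioo a b)ᶜ}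
      = Ioo a b \ Ioo (max a (a - y)) (min b (b - y)) := by
    ext x
    simp only [mem_inter_iff, mem_compl_iff, mem_Ioo, mem_ofPred_eq, Set.mem_sdiff, max_lt_iff,
      lt_min_iff]
    grind
  rw [hsdiff, measure_sdiff (Ioo_subset_Ioo (le_max_left _ _) (min_le_left _ _))
    measurableSet_Ioo.nullMeasurableSet (by simp), volume_Ioo, volume_Ioo]
  rcases le_total 0 (min b (b - y) - max a (a - y)) with h | h
  · rw [← ENNReal.ofReal_sub _ h]
    congr 1
    grind
  · rw [ENNReal.ofReal_of_nonpos h, tsub_zero]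
    congr 1
    grind

namespace StableProcess

variable {α : ℝ} (Y : StableProcess.{u} α)

attribute [local instance] StableProcess.mSample

/-- The law of the displacement `X t - X 0`. It is taken under `P 0`, but it is the same under
every `P x`, see `StableProcess.map_sub_eq_incrementLaw`. -/
noncomputable def incrementLaw (t : ℝ≥0) : Measure ℝ :=
  (Y.P 0).map (Y.X t - Y.X 0)

lemma measurable_sub (t : ℝ≥0) : Measurable (Y.X t - Y.X 0) :=
  (Y.measurable_X t).sub (Y.measurable_X 0)

lemma charFun_map_sub (x : ℝ) (t : ℝ≥0) (ξ : ℝ) :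
    charFun ((Y.P x).map (Y.X t - Y.X 0)) ξ = (exp (-(t : ℝ) * |ξ| ^ α) : ℝ) := by
  simpa using Y.charFun_increment x 0 t zero_le ξ

lemma charFun_incrementLaw (t : ℝ≥0) (ξ : ℝ) :
    charFun (Y.incrementLaw t) ξ = (exp (-(t : ℝ) * |ξ| ^ α) : ℝ) :=
  Y.charFun_map_sub 0 t ξ

instance isProbabilityMeasure_map_sub (x : ℝ) (t : ℝ≥0) :
    IsProbabilityMeasure ((Y.P x).map (Y.X t - Y.X 0)) :=
  have := Y.isProbabilityMeasure_P x
  Measure.isProbabilityMeasure_map (Y.measurable_sub t).aemeasurable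

instance isProbabilityMeasure_incrementLaw (t : ℝ≥0) : IsProbabilityMeasure (Y.incrementLaw t) :=
  Y.isProbabilityMeasure_map_sub 0 t

lemma map_sub_eq_incrementLaw (x : ℝ) (t : ℝ≥0) :
    (Y.P x).map (Y.X t - Y.X 0) = Y.incrementLaw t :=
  Measure.ext_of_charFun <| funext fun ξ => by rw [charFun_map_sub, charFun_incrementLaw]

lemma P_mem_eq_incrementLaw (x : ℝ) (t : ℝ≥0) {B : Set ℝ} (hB : MeasurableSet B) :
    Y.P x {ω | Y.X t ω ∈ B} = Y.incrementLaw t {y | x + y ∈ B} := by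
  have hxB : MeasurableSet {y | x + y ∈ B} := hB.preimage (measurable_const_add x)
  rw [← Y.map_sub_eq_incrementLaw x, Measure.map_apply (Y.measurable_sub t) hxB]
  refine measure_congr ?_
  filter_upwards [Y.start x] with ω hω
  refine propext ?_
  change Y.X t ω ∈ B ↔ x + (Y.X t ω - Y.X 0 ω) ∈ B
  rw [hω, add_sub_cancel]

lemma heat_eq_lintegral {A B : Set ℝ} (hB : MeasurableSet B) (t : ℝ≥0) :
    Y.heat A B t = ∫⁻ y, volume (A ∩ {x | x + y ∈ B}) ∂Y.incrementLaw t := by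
  have hS : MeasurableSet {p : ℝ × ℝ | p.1 + p.2 ∈ B} := hB.preimage measurable_add
  calc Y.heat A B t
      = ∫⁻ x in A, Y.incrementLaw t {y | x + y ∈ B} := by
        simp only [heat, Y.P_mem_eq_incrementLaw _ _ hB]
    _ = (volume.restrict A).prod (Y.incrementLaw t) {p : ℝ × ℝ | p.1 + p.2 ∈ B} :=
        (Measure.prod_apply hS).symm
    _ = ∫⁻ y, volume.restrict A {x | x + y ∈ B} ∂Y.incrementLaw t := Measure.prod_apply_symm hS
    _ = ∫⁻ y, volume (A ∩ {x | x + y ∈ B}) ∂Y.incrementLaw t :=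
        lintegral_congr fun y =>
          (Measure.restrict_apply (hB.preimage (measurable_add_const y))).trans
            (congrArg _ (inter_comm _ _))

lemma toReal_heat_Ioo_compl {a b : ℝ} (hab : a < b) (t : ℝ≥0) :
    (Y.heat (Ioo a b) (Ioo a b)ᶜ t).toReal = ∫ y, min |y| (b - a) ∂Y.incrementLaw t := by
  rw [Y.heat_eq_lintegral measurableSet_Ioo.compl, integral_eq_lintegral_of_nonneg_ae
    (Eventually.of_forall fun y => le_min (abs_nonneg _) (sub_nonneg.2 hab.le)) (by fun_prop)]
  simp_rw [volume_Ioo_inter_add_mem_compl hab]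

end StableProcess

/-- The normalized cosine transform `∫_0^∞ (1 - cos (c u)) (1 - exp (-u ^ α)) / u ^ 2 du`: by
scaling, it determines the heat content of an interval at all times. -/
noncomputable def stableProfile (α c : ℝ) : ℝ :=
  ∫ u in Ioi (0 : ℝ), (1 - cos (c * u)) * ((1 - exp (-u ^ α)) / u ^ 2)

lemma integral_one_sub_cos_mul_one_sub_exp_neg_mul_rpow {α s : ℝ} (hα : α ≠ 0) (hs : 0 < s)
    (L : ℝ) :
    ∫ u in Ioi (0 : ℝ), (1 - cos (L * u)) / u ^ 2 * (1 - exp (-s * u ^ α))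
      = s ^ (1 / α) * stableProfile α (L * s ^ (-(1 / α))) := by
  have hb : 0 < s ^ (1 / α) := rpow_pos_of_pos hs _
  have hscale := integral_comp_mul_left_Ioi' 
    (fun u : ℝ => (1 - cos (L * s ^ (-(1 / α)) * u)) * ((1 - exp (-u ^ α)) / u ^ 2)) 0 hb
  rw [mul_zero, smul_eq_mul] at hscale
  rw [stableProfile, ← hscale, ← mul_assoc, ← sq, ← integral_const_mul]
  refine setIntegral_congr_fun measurableSet_Ioi fun u (hu : 0 < u) => ?_
  have hcancel : L * s ^ (-(1 / α)) * (s ^ (1 / α) * u) = L * u := by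
    rw [rpow_neg hs.le]
    field_simp
  have hpow : (s ^ (1 / α) * u) ^ α = s * u ^ α := by
    rw [mul_rpow hb.le hu.le, ← rpow_mul hs.le, one_div_mul_cancel hα, rpow_one]
  rw [hcancel, hpow, neg_mul]
  field_simp

lemma StableProcess.toReal_heat_Ioo_compl_eq_stableProfile {α : ℝ} (hα : α ≠ 0)
    (Y : StableProcess.{u} α) {a b : ℝ} (hab : a < b) {t : ℝ≥0} (ht : 0 < t) :
    (Y.heat (Ioo a b) (Ioo a b)ᶜ t).toReal
      = 2 / π * ((t : ℝ) ^ (1 / α) * stableProfile α ((b - a) * (t : ℝ) ^ (-(1 / α)))) := by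
  rw [Y.toReal_heat_Ioo_compl hab, integral_min_abs_eq (sub_nonneg.2 hab.le),
    ← integral_one_sub_cos_mul_one_sub_exp_neg_mul_rpow hα (NNReal.coe_pos.2 ht)]
  congr 1
  refine setIntegral_congr_fun measurableSet_Ioi fun u (hu : 0 < u) => ?_
  simp only [charFun_incrementLaw, Complex.ofReal_re, abs_of_pos hu]

lemma StableProcess.toReal_heat_Ioo_compl_of_eq_one (Y : StableProcess.{u} 1) {a b : ℝ}
    (hab : a < b) {t : ℝ≥0} (ht : 0 < t) :
    (Y.heat (Ioo a b) (Ioo a b)ᶜ t).toReal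
      = 2 / π * t * log (1 / t)
        + 2 / π * ((b - a) * arctan (t / (b - a))
            + 1 / 2 * t * log ((t : ℝ) ^ 2 + (b - a) ^ 2)) := by
  have hL : 0 < b - a := sub_pos.2 hab
  have : (0 : ℝ) < t := NNReal.coe_pos.2 ht
  have hlog : log (1 + ((b - a) / t) ^ 2) = 2 * log (1 / t) + log ((t : ℝ) ^ 2 + (b - a) ^ 2) := by
    rw [show 1 + ((b - a) / t) ^ 2 = (1 / t : ℝ) ^ 2 * (t ^ 2 + (b - a) ^ 2) by field_simp,
      log_mul (by positivity) (by positivity), log_pow]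
    norm_num
  rw [Y.toReal_heat_Ioo_compl_eq_stableProfile one_ne_zero hab ht, div_one, rpow_one,
    rpow_neg_one, ← div_eq_mul_inv, stableProfile]
  simp only [rpow_one]
  rw [integral_one_sub_cos_mul_one_sub_exp_neg_div_sq (by positivity), hlog, one_div_div]
  field_simp
  ring

section ExpTaylorDefect

/-- The amount by which the Taylor polynomial of `exp (-s)` with `N` terms exceeds `exp (-s)`. -/
noncomputable def expTaylorDefect (N : ℕ) (s : ℝ) : ℝ :=
  ∑ n ∈ Finset.range N, (-s) ^ n / (n.factorial : ℝ) - exp (-s)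

lemma expTaylorDefect_zero (s : ℝ) : expTaylorDefect 0 s = -exp (-s) := by
  simp [expTaylorDefect]

lemma expTaylorDefect_one (s : ℝ) : expTaylorDefect 1 s = 1 - exp (-s) := by
  simp [expTaylorDefect]

lemma expTaylorDefect_succ (N : ℕ) (s : ℝ) :
    expTaylorDefect (N + 1) s = expTaylorDefect N s + (-s) ^ N / (N.factorial : ℝ) := by
  simp only [expTaylorDefect, Finset.sum_range_succ]
  ring

lemma hasDerivAt_pow_succ_div_factorial (N : ℕ) (s : ℝ) :
    HasDerivAt (fun s : ℝ => s ^ (N + 1) / ((N + 1).factorial : ℝ))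
      (s ^ N / (N.factorial : ℝ)) s := by
  refine ((hasDerivAt_pow (N + 1) s).div_const _).congr_deriv ?_
  rw [Nat.factorial_succ, Nat.cast_mul, mul_div_mul_left _ _ (by positivity), Nat.add_sub_cancel]

lemma hasDerivAt_expTaylorDefect_succ (N : ℕ) (s : ℝ) :
    HasDerivAt (expTaylorDefect (N + 1)) (-expTaylorDefect N s) s := by
  induction N with
  | zero =>
    rw [funext expTaylorDefect_one, expTaylorDefect_zero]
    simpa using (hasDerivAt_neg s).exp.const_sub 1
  | succ N ih =>
    rw [funext (expTaylorDefect_succ (N + 1))]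
    refine (ih.fun_add ((hasDerivAt_pow_succ_div_factorial N (-s)).comp s
      (hasDerivAt_neg s))).congr_deriv ?_
    rw [expTaylorDefect_succ]
    ring

lemma continuous_expTaylorDefect (N : ℕ) : Continuous (expTaylorDefect N) := by
  unfold expTaylorDefect
  fun_prop

lemma expTaylorDefect_succ_zero (N : ℕ) : expTaylorDefect (N + 1) 0 = 0 := by
  simp [expTaylorDefect, Finset.sum_range_succ']

lemma abs_expTaylorDefect_le (N : ℕ) {s : ℝ} (hs : 0 ≤ s) :
    |expTaylorDefect N s| ≤ s ^ N / (N.factorial : ℝ) := by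
  induction N generalizing s with
  | zero => simp [expTaylorDefect, hs]
  | succ N ih =>
    refine image_norm_le_of_norm_deriv_right_le_deriv_boundary (a := 0) (b := s)
      (fun x _ => (hasDerivAt_expTaylorDefect_succ N x).continuousAt.continuousWithinAt)
      (fun x _ => (hasDerivAt_expTaylorDefect_succ N x).hasDerivWithinAt) ?_
      (hasDerivAt_pow_succ_div_factorial N) (fun x hx => ?_) ⟨hs, le_rfl⟩
    · simp [expTaylorDefect_succ_zero]
    · rw [norm_neg]
      exact ih hx.1

lemma abs_expTaylorDefect_succ_le (N : ℕ) {s : ℝ} (hs : 0 ≤ s) :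
    |expTaylorDefect (N + 1) s| ≤ 2 * (s ^ N / (N.factorial : ℝ)) := by
  rw [expTaylorDefect_succ, two_mul]
  refine (abs_add_le _ _).trans (add_le_add (abs_expTaylorDefect_le N hs) (le_of_eq ?_))
  rw [abs_div, abs_pow, abs_neg, abs_of_nonneg hs, Nat.abs_cast]

end ExpTaylorDefect

section RpowBounds

variable {f : ℝ → ℝ} {A B p q : ℝ}

lemma integrableOn_Ioi_of_abs_le_rpow (hf : AEStronglyMeasurable f (volume.restrict (Ioi 0)))
    (hp : -1 < p) (hq : q < -1) (hA : ∀ u ∈ Ioc (0 : ℝ) 1, |f u| ≤ A * u ^ p)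
    (hB : ∀ u ∈ Ioi (1 : ℝ), |f u| ≤ B * u ^ q) : IntegrableOn f (Ioi 0) := by
  rw [← Ioc_union_Ioi_eq_Ioi zero_le_one, integrableOn_union]
  constructor
  · have h_int : IntegrableOn (fun u : ℝ => u ^ p) (Ioc 0 1) :=
      (intervalIntegrable_iff_integrableOn_Ioc_of_le zero_le_one).1
        (intervalIntegral.intervalIntegrable_rpow' hp)
    exact (h_int.const_mul A).mono' (hf.mono_set Ioc_subset_Ioi_self)
      ((ae_restrict_mem measurableSet_Ioc).mono hA)
  · exact ((integrableOn_Ioi_rpow_of_lt hq one_pos).const_mul B).mono'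
      (hf.mono_set (Ioi_subset_Ioi zero_le_one)) ((ae_restrict_mem measurableSet_Ioi).mono hB)

lemma tendsto_nhdsGT_zero_of_abs_le_rpow (hp : 0 < p) (hA : ∀ u, 0 < u → |f u| ≤ A * u ^ p) :
    Tendsto f (𝓝[>] 0) (𝓝 0) := by
  refine squeeze_zero_norm' (eventually_mem_nhdsWithin.mono hA) ?_
  have hlim := ((continuousAt_rpow_const 0 p (Or.inr hp.le)).tendsto.mono_left
    (nhdsWithin_le_nhds (s := Ioi 0))).const_mul A
  simpa [zero_rpow hp.ne'] using hlim

lemma tendsto_atTop_zero_of_abs_le_rpow (hq : q < 0) (hB : ∀ u, 0 < u → |f u| ≤ B * u ^ q) :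
    Tendsto f atTop (𝓝 0) := by
  refine squeeze_zero_norm' ((eventually_gt_atTop 0).mono hB) ?_
  simpa using (tendsto_rpow_neg_atTop (neg_pos.2 hq)).const_mul B

end RpowBounds

section CosineTransform

variable {β c : ℝ}

lemma integrableOn_abs_sin_mul_rpow (h1 : 1 < β) (h2 : β < 2) (c : ℝ) :
    IntegrableOn (fun u : ℝ => |sin (c * u)| * u ^ (β - 3)) (Ioi 0) := by
  refine integrableOn_Ioi_of_abs_le_rpow (p := β - 2) (q := β - 3) (A := |c|) (B := 1)
    (by fun_prop) (by linarith) (by linarith) (fun u hu => ?_) (fun u (hu : 1 < u) => ?_)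
  · have hu0 : 0 < u := hu.1
    rw [abs_mul, abs_abs, abs_of_pos (rpow_pos_of_pos hu0 _),
      show β - 2 = β - 3 + 1 by ring, rpow_add_one hu0.ne', mul_left_comm, mul_comm _ (|c| * u)]
    gcongr
    simpa [abs_mul, abs_of_pos hu0] using abs_sin_le_abs (x := c * u)
  · have hu0 : 0 < u := one_pos.trans hu
    rw [abs_mul, abs_abs, abs_of_pos (rpow_pos_of_pos hu0 _)]
    gcongr
    exact abs_sin_le_one _

lemma integral_abs_sin_mul_rpow (hc : 0 < c) :
    ∫ u in Ioi (0 : ℝ), |sin (c * u)| * u ^ (β - 3)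
      = c ^ (2 - β) * ∫ u in Ioi (0 : ℝ), |sin u| * u ^ (β - 3) := by
  have hscale := integral_comp_mul_left_Ioi' (fun u : ℝ => |sin u| * u ^ (β - 3)) 0 hc
  rw [mul_zero, smul_eq_mul] at hscale
  rw [← hscale, ← mul_assoc, ← rpow_add_one hc.ne', ← integral_const_mul]
  refine setIntegral_congr_fun measurableSet_Ioi fun u (hu : 0 < u) => ?_
  rw [mul_rpow hc.le hu.le, mul_left_comm, ← mul_assoc (c ^ _), ← rpow_add hc,
    show 2 - β + 1 + (β - 3) = 0 by ring, rpow_zero, one_mul]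

variable {h h' : ℝ → ℝ} {A B : ℝ}

lemma abs_mul_sin_div_le_of_abs_le {x a k : ℝ} (hc : 0 < c) (hx : |x| ≤ a) (u : ℝ)
    (hk : |sin (c * u)| ≤ k) : |x * (sin (c * u) / c)| ≤ a * (k / c) := by
  rw [abs_mul, abs_div, abs_of_pos hc]
  gcongr
  exact (abs_nonneg x).trans hx

lemma integrableOn_mul_sin_div (h1 : 1 < β) (h2 : β < 2) (hc : 0 < c)
    (hm : AEStronglyMeasurable h' (volume.restrict (Ioi 0)))
    (hB : ∀ u, 0 < u → |h' u| ≤ B * u ^ (β - 3)) :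
    IntegrableOn (fun u => h' u * (sin (c * u) / c)) (Ioi 0) ∧
      |∫ u in Ioi (0 : ℝ), h' u * (sin (c * u) / c)|
        ≤ B * (∫ u in Ioi (0 : ℝ), |sin u| * u ^ (β - 3)) * c ^ (1 - β) := by
  have hle : ∀ᵐ u ∂volume.restrict (Ioi (0 : ℝ)),
      ‖h' u * (sin (c * u) / c)‖ ≤ B / c * (|sin (c * u)| * u ^ (β - 3)) :=
    (ae_restrict_mem measurableSet_Ioi).mono fun u hu =>
      (abs_mul_sin_div_le_of_abs_le hc (hB u hu) u le_rfl).trans_eq (by ring)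
  have hdom := (integrableOn_abs_sin_mul_rpow h1 h2 c).const_mul (B / c)
  refine ⟨hdom.mono' (hm.mul (by fun_prop)) hle,
    (norm_integral_le_of_norm_le hdom hle).trans_eq ?_⟩
  rw [integral_const_mul, integral_abs_sin_mul_rpow hc, show 2 - β = 1 - β + 1 by ring,
    rpow_add_one hc.ne']
  field_simp

lemma hasDerivAt_sin_mul_div (hc : c ≠ 0) (u : ℝ) :
    HasDerivAt (fun u => sin (c * u) / c) (cos (c * u)) u := by
  refine ((hasDerivAt_const_mul c).sin.div_const c).congr_deriv ?_
  field_simp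

lemma abs_integral_mul_cos_le (h1 : 1 < β) (h2 : β < 2) (hc : 0 < c)
    (hd : ∀ u, 0 < u → HasDerivAt h (h' u) u) (hi : IntegrableOn h (Ioi 0))
    (hA : ∀ u, 0 < u → |h u| ≤ A * u ^ (β - 2))
    (hB : ∀ u, 0 < u → |h' u| ≤ B * u ^ (β - 3)) :
    |∫ u in Ioi (0 : ℝ), h u * cos (c * u)|
      ≤ B * (∫ u in Ioi (0 : ℝ), |sin u| * u ^ (β - 3)) * c ^ (1 - β) := by
  have hmeas : AEStronglyMeasurable h' (volume.restrict (Ioi 0)) :=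
    (measurable_deriv h).aestronglyMeasurable.congr
      ((ae_restrict_mem measurableSet_Ioi).mono fun u hu => (hd u hu).deriv)
  obtain ⟨h_int, hle⟩ := integrableOn_mul_sin_div h1 h2 hc hmeas hB
  have hzero : Tendsto (h * fun u => sin (c * u) / c) (𝓝[>] 0) (𝓝 0) :=
    tendsto_nhdsGT_zero_of_abs_le_rpow (sub_pos.2 h1) fun u hu => by
      refine (abs_mul_sin_div_le_of_abs_le hc (hA u hu) u (k := c * u) ?_).trans_eq ?_
      · simpa [abs_of_pos hc, abs_of_pos hu] using abs_sin_le_abs (x := c * u)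
      · rw [mul_div_cancel_left₀ _ hc.ne', mul_assoc, ← rpow_add_one hu.ne']
        ring_nf
  have hinfty : Tendsto (h * fun u => sin (c * u) / c) atTop (𝓝 0) :=
    tendsto_atTop_zero_of_abs_le_rpow (sub_neg.2 h2) fun u hu =>
      (abs_mul_sin_div_le_of_abs_le hc (hA u hu) u (abs_sin_le_one _)).trans_eq
        (mul_right_comm _ _ _)
  rw [integral_Ioi_mul_deriv_eq_deriv_mul hd (fun u _ => hasDerivAt_sin_mul_div hc.ne' u)
    (hi.mul_bdd (c := 1) (by fun_prop) (Eventually.of_forall fun u => abs_cos_le_one _)) h_int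
    hzero hinfty, sub_self, zero_sub, abs_neg]
  exact hle

lemma exists_abs_integral_one_sub_cos_mul_sub_le (h1 : 1 < β) (h2 : β < 2)
    (hd : ∀ u, 0 < u → HasDerivAt h (h' u) u) (hi : IntegrableOn h (Ioi 0))
    (hA : ∀ u, 0 < u → |h u| ≤ A * u ^ (β - 2))
    (hB : ∀ u, 0 < u → |h' u| ≤ B * u ^ (β - 3)) :
    ∃ K : ℝ, ∀ c, 0 < c →
      |(∫ u in Ioi (0 : ℝ), (1 - cos (c * u)) * h u) - ∫ u in Ioi (0 : ℝ), h u|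
        ≤ K * c ^ (1 - β) := by
  refine ⟨B * ∫ u in Ioi (0 : ℝ), |sin u| * u ^ (β - 3), fun c hc => ?_⟩
  have hcos : IntegrableOn (fun u => h u * cos (c * u)) (Ioi 0) :=
    hi.mul_bdd (c := 1) (by fun_prop) (Eventually.of_forall fun u => abs_cos_le_one _)
  simp only [one_sub_mul, mul_comm (cos _)]
  rw [integral_sub hi hcos, sub_sub_cancel_left, abs_neg]
  exact abs_integral_mul_cos_le h1 h2 hc hd hi hA hB

end CosineTransform

section TaylorKernel

/-- The integral kernel of `stableProfile α`, which is the case `N = 1`, with `1 - exp (-u ^ α)`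
replaced by the Taylor defect of order `N`. -/
noncomputable def taylorKernel (α : ℝ) (N : ℕ) (u : ℝ) : ℝ :=
  expTaylorDefect N (u ^ α) / u ^ 2

variable {α u c : ℝ}

lemma rpow_pow_div_sq (hu : 0 < u) (N : ℕ) : (u ^ α) ^ N / u ^ 2 = u ^ (N * α - 2) := by
  rw [rpow_sub hu, rpow_two, mul_comm, rpow_mul_natCast hu.le]

lemma taylorKernel_succ (N : ℕ) (hu : 0 < u) :
    taylorKernel α (N + 1) u
      = taylorKernel α N u + (-1) ^ N / (N.factorial : ℝ) * u ^ (N * α - 2) := by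
  rw [taylorKernel, expTaylorDefect_succ, add_div, neg_pow, ← rpow_pow_div_sq hu, taylorKernel]
  ring

lemma abs_taylorKernel_le (N : ℕ) (hu : 0 < u) :
    |taylorKernel α N u| ≤ 1 / (N.factorial : ℝ) * u ^ (N * α - 2) := by
  rw [taylorKernel, abs_div, abs_of_pos (by positivity : 0 < u ^ 2), ← rpow_pow_div_sq hu,
    one_div_mul_eq_div, div_right_comm]
  gcongr
  exact abs_expTaylorDefect_le N (rpow_nonneg hu.le α)

lemma abs_taylorKernel_succ_le (N : ℕ) (hu : 0 < u) :
    |taylorKernel α (N + 1) u| ≤ 2 / (N.factorial : ℝ) * u ^ (N * α - 2) := by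
  rw [taylorKernel, abs_div, abs_of_pos (by positivity : 0 < u ^ 2), ← rpow_pow_div_sq hu,
    div_mul_div_comm, ← div_div, mul_div_assoc]
  gcongr
  exact abs_expTaylorDefect_succ_le N (rpow_nonneg hu.le α)

lemma hasDerivAt_taylorKernel_succ (N : ℕ) (hu : 0 < u) :
    HasDerivAt (taylorKernel α (N + 1))
      (-(α * u ^ (α - 1) * taylorKernel α N u) - 2 * taylorKernel α (N + 1) u / u) u := by
  have hcomp := (hasDerivAt_expTaylorDefect_succ N (u ^ α)).comp u
    (hasDerivAt_rpow_const (p := α) (Or.inl hu.ne'))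
  refine (hcomp.fun_div (hasDerivAt_pow 2 u) (by positivity)).congr_deriv ?_
  simp only [taylorKernel, Function.comp]
  field_simp
  ring

lemma abs_deriv_taylorKernel_succ_le (hα : 0 ≤ α) (N : ℕ) (hu : 0 < u) :
    |-(α * u ^ (α - 1) * taylorKernel α N u) - 2 * taylorKernel α (N + 1) u / u|
      ≤ (α / (N.factorial : ℝ) + 2 / ((N + 1).factorial : ℝ)) * u ^ ((N + 1 : ℕ) * α - 3) := by
  have hfst : u ^ (α - 1) * u ^ (N * α - 2) = u ^ ((N + 1 : ℕ) * α - 3) := by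
    rw [← rpow_add hu]
    push_cast
    ring_nf
  have hsnd : u ^ ((N + 1 : ℕ) * α - 2) / u = u ^ ((N + 1 : ℕ) * α - 3) := by
    rw [← rpow_sub_one hu.ne']
    ring_nf
  have hpos : 0 ≤ α * u ^ (α - 1) := mul_nonneg hα (rpow_nonneg hu.le _)
  calc |-(α * u ^ (α - 1) * taylorKernel α N u) - 2 * taylorKernel α (N + 1) u / u|
      ≤ α * u ^ (α - 1) * |taylorKernel α N u| + 2 * |taylorKernel α (N + 1) u| / u := by
        refine (abs_sub _ _).trans_eq ?_
        rw [abs_neg, abs_mul, abs_of_nonneg hpos, abs_div, abs_mul, abs_two, abs_of_pos hu]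
    _ ≤ α * u ^ (α - 1) * (1 / (N.factorial : ℝ) * u ^ (N * α - 2))
          + 2 * (1 / ((N + 1).factorial : ℝ) * u ^ ((N + 1 : ℕ) * α - 2)) / u := by
        gcongr
        · exact abs_taylorKernel_le N hu
        · exact abs_taylorKernel_le (N + 1) hu
    _ = α / (N.factorial : ℝ) * (u ^ (α - 1) * u ^ (N * α - 2))
          + 2 / ((N + 1).factorial : ℝ) * (u ^ ((N + 1 : ℕ) * α - 2) / u) := by ring
    _ = _ := by rw [hfst, hsnd, ← add_mul]

lemma continuousOn_taylorKernel (α : ℝ) (N : ℕ) : ContinuousOn (taylorKernel α N) (Ioi 0) := by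
  have hrpow : ContinuousOn (fun u : ℝ => u ^ α) (Ioi 0) :=
    continuousOn_id.rpow_const fun u hu => Or.inl hu.ne'
  exact ((continuous_expTaylorDefect N).comp_continuousOn hrpow).div (continuousOn_pow 2)
    fun u hu => (pow_pos hu 2).ne'

lemma integrableOn_taylorKernel_succ {N : ℕ} (h0 : N * α < 1) (h1 : 1 < (N + 1 : ℕ) * α) :
    IntegrableOn (taylorKernel α (N + 1)) (Ioi 0) :=
  integrableOn_Ioi_of_abs_le_rpow
    ((continuousOn_taylorKernel α _).aestronglyMeasurable measurableSet_Ioi)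
    (by linarith) (by linarith) (fun _ hu => abs_taylorKernel_le _ hu.1)
    (fun _ hu => abs_taylorKernel_succ_le _ (one_pos.trans hu))

lemma integrableOn_one_sub_cos_mul_taylorKernel_succ (hα : 0 ≤ α) {N : ℕ} (hN : N * α < 1)
    (hc : 0 < c) :
    IntegrableOn (fun u => (1 - cos (c * u)) * taylorKernel α (N + 1) u) (Ioi 0) := by
  refine ((integrableOn_one_sub_cos_mul_rpow (by linarith [mul_nonneg N.cast_nonneg hα]) hN
    hc).const_mul (2 / (N.factorial : ℝ))).mono'
    ((Continuous.aestronglyMeasurable (by fun_prop)).mul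
      ((continuousOn_taylorKernel α _).aestronglyMeasurable measurableSet_Ioi))
    ((ae_restrict_mem measurableSet_Ioi).mono fun u hu => ?_)
  have hcos : 0 ≤ 1 - cos (c * u) := sub_nonneg.2 (cos_le_one _)
  rw [norm_mul, norm_of_nonneg hcos, mul_left_comm]
  gcongr
  exact abs_taylorKernel_succ_le N hu

/-- The coefficient of `c ^ (1 - n * α)` in the expansion of `stableProfile α c` as `c → ∞`. -/
noncomputable def stableCoeff (α : ℝ) (n : ℕ) : ℝ :=
  (-1) ^ (n - 1) * (Gamma (n * α) / ((1 - n * α) * (n.factorial : ℝ))) * sin (π * n * α / 2)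

lemma integral_one_sub_cos_mul_taylorKernel_succ (hα : 0 < α) {N : ℕ}
    (hN : (N + 1 : ℕ) * α < 1) (hc : 0 < c) :
    ∫ u in Ioi (0 : ℝ), (1 - cos (c * u)) * taylorKernel α (N + 1) u
      = stableCoeff α (N + 1) * c ^ (1 - (N + 1 : ℕ) * α)
        + ∫ u in Ioi (0 : ℝ), (1 - cos (c * u)) * taylorKernel α (N + 2) u := by
  have hpos : 0 < (N + 1 : ℕ) * α := by positivity
  have hsplit : ∀ u ∈ Ioi (0 : ℝ), (1 - cos (c * u)) * taylorKernel α (N + 1) u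
      = (-1) ^ N / ((N + 1).factorial : ℝ) * ((1 - cos (c * u)) * u ^ ((N + 1 : ℕ) * α - 2))
        + (1 - cos (c * u)) * taylorKernel α (N + 2) u := by
    intro u hu
    rw [taylorKernel_succ (N + 1) hu, pow_succ]
    ring
  rw [setIntegral_congr_fun measurableSet_Ioi hsplit,
    integral_add ((integrableOn_one_sub_cos_mul_rpow (by linarith) hN hc).const_mul _)
      (integrableOn_one_sub_cos_mul_taylorKernel_succ hα.le hN hc),
    integral_const_mul, integral_one_sub_cos_mul_rpow_eq_sin hpos hN hc, stableCoeff,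
    Nat.add_sub_cancel, ← mul_assoc π]
  field_simp

lemma stableProfile_eq_sum_add_integral (hα : 0 < α) (hc : 0 < c) {N : ℕ} (hN : N * α < 1) :
    stableProfile α c = ∑ n ∈ Finset.Icc 1 N, stableCoeff α n * c ^ (1 - n * α)
      + ∫ u in Ioi (0 : ℝ), (1 - cos (c * u)) * taylorKernel α (N + 1) u := by
  induction N with
  | zero => simp [stableProfile, taylorKernel, expTaylorDefect_one]
  | succ N ih =>
    have hle : (N : ℝ) * α ≤ (N + 1 : ℕ) * α := by gcongr; simp
    rw [ih (hle.trans_lt hN), integral_one_sub_cos_mul_taylorKernel_succ hα hN hc,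
      Finset.sum_Icc_succ_top (by omega), add_assoc]

end TaylorKernel

section GammaIntegral

variable {x : ℝ} {M : ℕ}

lemma abs_rpow_mul_expTaylorDefect_le (x : ℝ) (M : ℕ) {s : ℝ} (hs : 0 < s) :
    |s ^ x * expTaylorDefect M s| ≤ 1 / (M.factorial : ℝ) * s ^ (x + M) := by
  rw [abs_mul, abs_of_pos (rpow_pos_of_pos hs x), rpow_add hs, rpow_natCast, mul_left_comm,
    one_div_mul_eq_div]
  gcongr
  exact abs_expTaylorDefect_le M hs.le

lemma abs_rpow_mul_expTaylorDefect_succ_le (x : ℝ) (M : ℕ) {s : ℝ} (hs : 0 < s) :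
    |s ^ x * expTaylorDefect (M + 1) s| ≤ 2 / (M.factorial : ℝ) * s ^ (x + M) := by
  rw [abs_mul, abs_of_pos (rpow_pos_of_pos hs x), rpow_add hs, rpow_natCast, mul_left_comm,
    div_mul_eq_mul_div, mul_div_assoc]
  gcongr
  exact abs_expTaylorDefect_succ_le M hs.le

lemma integrableOn_rpow_mul_expTaylorDefect (h0 : -M < x) (h1 : x < 1 - M) :
    IntegrableOn (fun s => s ^ (x - 1) * expTaylorDefect M s) (Ioi 0) := by
  cases M with
  | zero =>
    refine (GammaIntegral_convergent (by simpa using h0)).neg.congr_fun (fun s _ => ?_)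
      measurableSet_Ioi
    simp [expTaylorDefect_zero, mul_comm]
  | succ M =>
    push_cast at h0 h1
    refine integrableOn_Ioi_of_abs_le_rpow ?_ (p := x - 1 + (M + 1 : ℕ)) (q := x - 1 + M)
      (by push_cast; linarith) (by linarith)
      (fun s hs => abs_rpow_mul_expTaylorDefect_le _ _ hs.1)
      (fun s hs => abs_rpow_mul_expTaylorDefect_succ_le _ _ (one_pos.trans hs))
    have := continuous_expTaylorDefect (M + 1)
    fun_prop

lemma integral_rpow_mul_expTaylorDefect_succ (h0 : -(M + 1 : ℕ) < x) (h1 : x < -M) :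
    ∫ s in Ioi (0 : ℝ), s ^ (x - 1) * expTaylorDefect (M + 1) s
      = x⁻¹ * ∫ s in Ioi (0 : ℝ), s ^ x * expTaylorDefect M s := by
  have hx : x ≠ 0 := (h1.trans_le (neg_nonpos.2 M.cast_nonneg)).ne
  have hderiv : ∀ s ∈ Ioi (0 : ℝ), HasDerivAt (fun s => x⁻¹ * s ^ x) (s ^ (x - 1)) s := by
    intro s hs
    refine ((hasDerivAt_rpow_const (Or.inl (ne_of_gt hs))).const_mul x⁻¹).congr_deriv ?_
    field_simp
  have h_int := (integrableOn_rpow_mul_expTaylorDefect (x := x) h0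
    (by push_cast; linarith)).congr_fun (fun s _ => mul_comm _ _) measurableSet_Ioi
  have h_int' := (integrableOn_rpow_mul_expTaylorDefect (x := x + 1) (M := M)
    (by push_cast at h0; linarith) (by linarith)).const_mul (-x⁻¹)
  rw [add_sub_cancel_right] at h_int'
  have hparts : ∀ s, -expTaylorDefect M s * (x⁻¹ * s ^ x) = -x⁻¹ * (s ^ x * expTaylorDefect M s) :=
    fun s => by ring
  have hzero : Tendsto (fun s => s ^ x * expTaylorDefect (M + 1) s) (𝓝[>] 0) (𝓝 0) :=
    tendsto_nhdsGT_zero_of_abs_le_rpow (neg_lt_iff_pos_add.1 h0)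
      fun s hs => abs_rpow_mul_expTaylorDefect_le x (M + 1) hs
  have hinfty : Tendsto (fun s => s ^ x * expTaylorDefect (M + 1) s) atTop (𝓝 0) :=
    tendsto_atTop_zero_of_abs_le_rpow (lt_neg_iff_add_neg.1 h1)
      fun s hs => abs_rpow_mul_expTaylorDefect_succ_le x M hs
  have hboundary : (expTaylorDefect (M + 1) * fun s => x⁻¹ * s ^ x)
      = fun s => x⁻¹ * (s ^ x * expTaylorDefect (M + 1) s) := by
    ext s
    simp only [Pi.mul_apply]
    ring
  simp only [mul_comm (_ ^ (x - 1))]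
  rw [integral_Ioi_mul_deriv_eq_deriv_mul (fun s _ => hasDerivAt_expTaylorDefect_succ M s) hderiv
    h_int (h_int'.congr (Eventually.of_forall fun s => (hparts s).symm))
    (by rw [hboundary]; exact hzero.const_mul x⁻¹) (by rw [hboundary]; exact hinfty.const_mul x⁻¹)]
  simp only [hparts, integral_const_mul]
  ring

lemma integral_rpow_mul_expTaylorDefect (h0 : -M < x) (h1 : x < 1 - M) :
    ∫ s in Ioi (0 : ℝ), s ^ (x - 1) * expTaylorDefect M s = -Gamma x := by
  induction M generalizing x with
  | zero =>
    rw [Gamma_eq_integral (by simpa using h0), ← integral_neg]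
    refine setIntegral_congr_fun measurableSet_Ioi fun s _ => ?_
    simp [expTaylorDefect_zero, mul_comm]
  | succ M ih =>
    have hx : x < -M := by push_cast at h1; linarith
    have hih := ih (x := x + 1) (by push_cast at h0; linarith) (by linarith)
    have hx0 : x ≠ 0 := (hx.trans_le (neg_nonpos.2 M.cast_nonneg)).ne
    rw [add_sub_cancel_right, Gamma_add_one hx0] at hih
    rw [integral_rpow_mul_expTaylorDefect_succ h0 hx, hih]
    field_simp

lemma integral_taylorKernel {α : ℝ} {N : ℕ} (hα : 0 < α) (h0 : N * α < 1)
    (h1 : 1 < (N + 1 : ℕ) * α) :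
    ∫ u in Ioi (0 : ℝ), taylorKernel α (N + 1) u = Gamma (1 - 1 / α) := by
  have hinv : α * (1 / α) = 1 := mul_one_div_cancel hα.ne'
  have hsubst := integral_comp_rpow_Ioi_of_pos
    (g := fun s => s ^ (-(1 / α) - 1) * expTaylorDefect (N + 1) s) hα
  rw [integral_rpow_mul_expTaylorDefect (by rw [neg_lt_neg_iff, div_lt_iff₀ hα]; exact h1)
    (by push_cast; rw [sub_add_cancel_right, neg_lt_neg_iff, lt_div_iff₀ hα]; exact h0)] at hsubst
  have hker : ∀ u ∈ Ioi (0 : ℝ),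
      (α * u ^ (α - 1)) • ((u ^ α) ^ (-(1 / α) - 1) * expTaylorDefect (N + 1) (u ^ α))
        = α * taylorKernel α (N + 1) u := by
    intro u (hu : 0 < u)
    have hexp : u ^ (α - 1) * (u ^ α) ^ (-(1 / α) - 1) = (u ^ 2)⁻¹ := by
      rw [← rpow_mul hu.le, ← rpow_add hu, ← rpow_two, ← rpow_neg hu.le]
      congr 1
      linear_combination -hinv
    rw [smul_eq_mul, taylorKernel, div_eq_inv_mul (expTaylorDefect _ _), ← hexp]
    ring
  rw [setIntegral_congr_fun measurableSet_Ioi hker, integral_const_mul] at hsubst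
  rw [sub_eq_neg_add, Gamma_add_one (neg_ne_zero.2 (one_div_ne_zero hα.ne')),
    ← mul_right_inj' hα.ne', hsubst]
  field_simp

end GammaIntegral

lemma exists_abs_stableProfile_sub_le {α : ℝ} {N : ℕ} (hα : 0 < α) (h0 : N * α < 1)
    (h1 : 1 < (N + 1 : ℕ) * α) (h2 : (N + 1 : ℕ) * α < 2) :
    ∃ K : ℝ, ∀ c, 0 < c →
      |stableProfile α c
          - (∑ n ∈ Finset.Icc 1 N, stableCoeff α n * c ^ (1 - n * α) + Gamma (1 - 1 / α))|
        ≤ K * c ^ (1 - (N + 1 : ℕ) * α) := by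
  obtain ⟨K, hK⟩ := exists_abs_integral_one_sub_cos_mul_sub_le h1 h2
    (fun _ hu => hasDerivAt_taylorKernel_succ N hu) (integrableOn_taylorKernel_succ h0 h1)
    (fun _ hu => abs_taylorKernel_le (N + 1) hu)
    (fun _ hu => abs_deriv_taylorKernel_succ_le hα.le N hu)
  refine ⟨K, fun c hc => ?_⟩
  rw [stableProfile_eq_sum_add_integral hα hc h0, add_sub_add_left_eq_sub,
    ← integral_taylorKernel hα h0 h1]
  exact hK c hc

section ResonantKernel

lemma le_rpow_of_le_one_of_le {x u p : ℝ} (hu : 0 < u) (hp0 : 0 ≤ p) (hp1 : p ≤ 1) (h1 : x ≤ 1)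
    (h2 : x ≤ u) : x ≤ u ^ p := by
  rcases le_total u 1 with h | h
  · exact h2.trans (self_le_rpow_of_le_one hu.le h hp1)
  · exact h1.trans (one_le_rpow h hp0)

variable {β u : ℝ}

lemma abs_one_sub_exp_neg_div_le (hβ1 : 1 ≤ β) (hβ2 : β ≤ 2) (hu : 0 < u) :
    |(1 - exp (-u)) / u| ≤ u ^ (β - 2) := by
  have hexp : exp (-u) ≤ 1 := exp_le_one_iff.2 (by linarith)
  rw [abs_of_nonneg (div_nonneg (sub_nonneg.2 hexp) hu.le), div_le_iff₀ hu,
    ← rpow_add_one hu.ne']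
  exact le_rpow_of_le_one_of_le hu (by linarith) (by linarith) (by linarith [exp_pos (-u)])
    (by linarith [add_one_le_exp (-u)])

lemma hasDerivAt_one_sub_exp_neg_div (hu : u ≠ 0) :
    HasDerivAt (fun u : ℝ => (1 - exp (-u)) / u) (-((1 - (1 + u) * exp (-u)) / u ^ 2)) u := by
  have hnum : HasDerivAt (fun u : ℝ => 1 - exp (-u)) (exp (-u)) u := by
    simpa using (hasDerivAt_neg u).exp.const_sub 1
  refine (hnum.fun_div (hasDerivAt_id' u) hu).congr_deriv ?_
  field_simp
  ring

lemma abs_deriv_one_sub_exp_neg_div_le (hβ1 : 1 ≤ β) (hβ2 : β ≤ 2) (hu : 0 < u) :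
    |-((1 - (1 + u) * exp (-u)) / u ^ 2)| ≤ u ^ (β - 3) := by
  have hnonneg : (1 + u) * exp (-u) ≤ 1 := by
    rw [exp_neg, ← div_eq_mul_inv, div_le_one (exp_pos _), add_comm]
    exact add_one_le_exp u
  have hlower : 1 - u ≤ exp (-u) := by linarith [add_one_le_exp (-u)]
  rw [abs_neg, abs_of_nonneg (div_nonneg (sub_nonneg.2 hnonneg) (sq_nonneg u)),
    div_le_iff₀ (by positivity), ← rpow_two, ← rpow_add hu]
  have hexp := exp_pos (-u)
  exact le_rpow_of_le_one_of_le hu (by linarith) (by linarith) (by nlinarith) (by nlinarith)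

variable {α c : ℝ} {N : ℕ}

/-- In the resonant case `(N + 1) * α = 1` the kernel `taylorKernel α (N + 1)` has a simple pole at
the origin; subtracting the same multiple of `exp (-u) / u` makes it integrable. -/
noncomputable def resonantKernel (α : ℝ) (N : ℕ) (u : ℝ) : ℝ :=
  taylorKernel α (N + 1) u - (-1) ^ N / ((N + 1).factorial : ℝ) * (exp (-u) / u)

lemma resonantKernel_eq_add (hα : (N + 1 : ℕ) * α = 1) (hu : 0 < u) :
    resonantKernel α N u
      = taylorKernel α (N + 2) u + (-1) ^ N / ((N + 1).factorial : ℝ) * ((1 - exp (-u)) / u) := by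
  rw [resonantKernel, taylorKernel_succ (N + 1) hu, hα, show (1 : ℝ) - 2 = -1 by norm_num,
    rpow_neg_one, pow_succ]
  ring

lemma hasDerivAt_resonantKernel (hα : (N + 1 : ℕ) * α = 1) (hu : 0 < u) :
    HasDerivAt (resonantKernel α N)
      (-(α * u ^ (α - 1) * taylorKernel α (N + 1) u) - 2 * taylorKernel α (N + 2) u / u
        + (-1) ^ N / ((N + 1).factorial : ℝ) * -((1 - (1 + u) * exp (-u)) / u ^ 2)) u :=
  ((hasDerivAt_taylorKernel_succ (N + 1) hu).fun_add
    ((hasDerivAt_one_sub_exp_neg_div hu.ne').const_mul _)).congr_of_eventuallyEq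
      ((lt_mem_nhds hu).mono fun _ hv => resonantKernel_eq_add hα hv)

lemma abs_add_mul_le_of_abs_le {x y a b z k : ℝ} (hx : |x| ≤ a * z) (hy : |y| ≤ b * z) :
    |x + k * y| ≤ (a + |k| * b) * z := by
  rw [add_mul, mul_assoc]
  refine (abs_add_le _ _).trans (add_le_add hx ?_)
  rw [abs_mul]
  gcongr

lemma pos_of_succ_mul_eq_one (hα : (N + 1 : ℕ) * α = 1) : 0 < α :=
  pos_of_mul_pos_right (hα ▸ one_pos) (Nat.cast_nonneg _)

lemma abs_resonantKernel_le (hα : (N + 1 : ℕ) * α = 1) (hα1 : α ≤ 1) (hu : 0 < u) :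
    |resonantKernel α N u|
      ≤ (1 / ((N + 2).factorial : ℝ) + |(-1) ^ N / ((N + 1).factorial : ℝ)| * 1)
        * u ^ ((N + 2 : ℕ) * α - 2) := by
  have hα0 : 0 < α := pos_of_succ_mul_eq_one hα
  have hβ : (N + 2 : ℕ) * α = 1 + α := by push_cast at hα ⊢; linarith
  rw [resonantKernel_eq_add hα hu]
  refine abs_add_mul_le_of_abs_le (abs_taylorKernel_le (N + 2) hu) ?_
  rw [one_mul]
  exact abs_one_sub_exp_neg_div_le (by linarith) (by linarith) hu

lemma integrableOn_resonantKernel (hα : (N + 1 : ℕ) * α = 1) (hα1 : α < 1) :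
    IntegrableOn (resonantKernel α N) (Ioi 0) := by
  have hα0 : 0 < α := pos_of_succ_mul_eq_one hα
  have hβ : (N + 2 : ℕ) * α = 1 + α := by push_cast at hα ⊢; linarith
  have hN : N * α = 1 - α := by push_cast at hα; linarith
  refine integrableOn_Ioi_of_abs_le_rpow (p := (N + 2 : ℕ) * α - 2) (q := N * α - 2)
    (B := 2 / (N.factorial : ℝ) + |(-1) ^ N / ((N + 1).factorial : ℝ)| * 1)
    (ContinuousOn.aestronglyMeasurable (fun u hu =>
      (hasDerivAt_resonantKernel hα hu).continuousAt.continuousWithinAt) measurableSet_Ioi)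
    (by linarith) (by linarith) (fun u hu => abs_resonantKernel_le hα hα1.le hu.1)
    (fun u (hu : 1 < u) => ?_)
  have hu0 : 0 < u := one_pos.trans hu
  rw [resonantKernel, sub_eq_add_neg, ← mul_neg]
  refine abs_add_mul_le_of_abs_le (abs_taylorKernel_succ_le N hu0) ?_
  have hexp : exp (-u) ≤ u⁻¹ := by
    rw [exp_neg]
    exact inv_anti₀ hu0 (by linarith [add_one_le_exp u])
  calc |-(exp (-u) / u)| = exp (-u) / u := by rw [abs_neg, abs_of_nonneg (by positivity)]
    _ ≤ u⁻¹ / u := by gcongr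
    _ = u ^ (-2 : ℝ) := by rw [rpow_neg hu0.le, rpow_two]; field_simp
    _ ≤ 1 * u ^ (N * α - 2) := by
        rw [one_mul]
        exact rpow_le_rpow_of_exponent_le hu.le (by linarith)

lemma abs_deriv_resonantKernel_le (hα : (N + 1 : ℕ) * α = 1) (hα1 : α ≤ 1) (hu : 0 < u) :
    |-(α * u ^ (α - 1) * taylorKernel α (N + 1) u) - 2 * taylorKernel α (N + 2) u / u
        + (-1) ^ N / ((N + 1).factorial : ℝ) * -((1 - (1 + u) * exp (-u)) / u ^ 2)|
      ≤ (α / ((N + 1).factorial : ℝ) + 2 / ((N + 2).factorial : ℝ)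
          + |(-1) ^ N / ((N + 1).factorial : ℝ)| * 1) * u ^ ((N + 2 : ℕ) * α - 3) := by
  have hα0 : 0 < α := pos_of_succ_mul_eq_one hα
  have hβ : (N + 2 : ℕ) * α = 1 + α := by push_cast at hα ⊢; linarith
  refine abs_add_mul_le_of_abs_le (abs_deriv_taylorKernel_succ_le hα0.le (N + 1) hu) ?_
  rw [one_mul]
  exact abs_deriv_one_sub_exp_neg_div_le (by linarith) (by linarith) hu

end ResonantKernel

lemma log_one_add_le_rpow_div {y p : ℝ} (hy : 0 ≤ y) (hp0 : 0 < p) (hp1 : p ≤ 1) :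
    log (1 + y) ≤ y ^ p / p := by
  have hsub : (1 + y) ^ p ≤ 1 + y ^ p := by
    simpa using rpow_add_le_add_rpow zero_le_one hy hp0.le hp1
  rw [le_div_iff₀' hp0, ← log_rpow (by positivity)]
  exact (log_le_log (by positivity) hsub).trans
    ((log_le_sub_one_of_pos (by positivity)).trans_eq (add_sub_cancel_left _ _))

lemma abs_half_log_one_add_sq_sub_log_le {α c : ℝ} (hα0 : 0 < α) (hα2 : α ≤ 2) (hc : 0 < c) :
    |1 / 2 * log (1 + c ^ 2) - log c| ≤ 1 / α * c ^ (-α) := by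
  have hpow : (c⁻¹ ^ 2) ^ (α / 2) = c ^ (-α) := by
    rw [← rpow_natCast_mul (by positivity), inv_rpow hc.le, rpow_neg hc.le]
    congr 2
    push_cast
    ring
  have hsplit : 1 / 2 * log (1 + c ^ 2) - log c = 1 / 2 * log (1 + c⁻¹ ^ 2) := by
    rw [show 1 + c ^ 2 = c ^ 2 * (1 + c⁻¹ ^ 2) by field_simp; ring,
      log_mul (by positivity) (by positivity), log_pow]
    push_cast
    ring
  have hle := log_one_add_le_rpow_div (sq_nonneg c⁻¹) (half_pos hα0) (by linarith)
  rw [hpow] at hle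
  rw [hsplit, abs_of_nonneg (mul_nonneg one_half_pos.le (log_nonneg (by simp [sq_nonneg])))]
  calc 1 / 2 * log (1 + c⁻¹ ^ 2) ≤ 1 / 2 * (c ^ (-α) / (α / 2)) := by gcongr
    _ = 1 / α * c ^ (-α) := by field_simp

lemma integral_one_sub_cos_mul_taylorKernel_of_resonant {α c : ℝ} {N : ℕ}
    (hα : (N + 1 : ℕ) * α = 1) (hα1 : α < 1) :
    ∫ u in Ioi (0 : ℝ), (1 - cos (c * u)) * taylorKernel α (N + 1) u
      = (∫ u in Ioi (0 : ℝ), (1 - cos (c * u)) * resonantKernel α N u)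
        + (-1) ^ N / ((N + 1).factorial : ℝ) * (1 / 2 * log (1 + c ^ 2)) := by
  have hsplit : ∀ u, (1 - cos (c * u)) * taylorKernel α (N + 1) u
      = (1 - cos (c * u)) * resonantKernel α N u
        + (-1) ^ N / ((N + 1).factorial : ℝ) * ((1 - cos (c * u)) * (exp (-u) / u)) := by
    intro u
    rw [resonantKernel]
    ring
  have h_int : IntegrableOn (fun u => (1 - cos (c * u)) * resonantKernel α N u) (Ioi 0) :=
    (integrableOn_resonantKernel hα hα1).bdd_mul (c := 2) (by fun_prop)
      (Eventually.of_forall fun u => by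
        rw [norm_of_nonneg (sub_nonneg.2 (cos_le_one _))]
        linarith [neg_one_le_cos (c * u)])
  simp only [hsplit]
  rw [integral_add h_int ((integrableOn_one_sub_cos_mul_exp_neg_div c).const_mul _),
    integral_const_mul, integral_one_sub_cos_mul_exp_neg_div]

lemma exists_abs_stableProfile_sub_le_of_resonant {α : ℝ} {N : ℕ} (hα : (N + 1 : ℕ) * α = 1)
    (hα1 : α < 1) :
    ∃ I K : ℝ, ∀ c, 0 < c →
      |stableProfile α c - (∑ n ∈ Finset.Icc 1 N, stableCoeff α n * c ^ (1 - n * α)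
          + ((-1) ^ N / ((N + 1).factorial : ℝ) * log c + I))|
        ≤ K * c ^ (1 - (N + 2 : ℕ) * α) := by
  have hα0 : 0 < α := pos_of_succ_mul_eq_one hα
  have hN : N * α < 1 := by push_cast at hα; linarith
  have hβ : (N + 2 : ℕ) * α = 1 + α := by push_cast at hα ⊢; linarith
  obtain ⟨K, hK⟩ := exists_abs_integral_one_sub_cos_mul_sub_le (by linarith) (by linarith)
    (fun _ hu => hasDerivAt_resonantKernel hα hu) (integrableOn_resonantKernel hα hα1)
    (fun _ hu => abs_resonantKernel_le hα hα1.le hu)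
    (fun _ hu => abs_deriv_resonantKernel_le hα hα1.le hu)
  refine ⟨∫ u in Ioi (0 : ℝ), resonantKernel α N u,
    K + |(-1) ^ N / ((N + 1).factorial : ℝ)| * (1 / α), fun c hc => ?_⟩
  have hlog := abs_half_log_one_add_sq_sub_log_le hα0 (by linarith) hc
  rw [← sub_add_cancel_left 1 α, ← hβ] at hlog
  rw [stableProfile_eq_sum_add_integral hα0 hc hN, add_sub_add_left_eq_sub,
    integral_one_sub_cos_mul_taylorKernel_of_resonant hα hα1]
  refine le_trans (le_of_eq ?_) (abs_add_mul_le_of_abs_le (hK c hc) hlog)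
  congr 1
  ring

section HeatExpansion

variable {α a b : ℝ}

lemma rpow_one_div_mul_rpow_scale {L t : ℝ} (hα : α ≠ 0) (hL : 0 < L) (ht : 0 < t) (m : ℕ) :
    t ^ (1 / α) * (L * t ^ (-(1 / α))) ^ (1 - m * α) = L ^ (1 - m * α) * t ^ m := by
  rw [mul_rpow hL.le (rpow_nonneg ht.le _), ← rpow_mul ht.le, mul_left_comm, ← rpow_add ht,
    ← rpow_natCast]
  congr 2
  field_simp
  ring

lemma rpow_one_div_mul_sum_rpow_scale {L t : ℝ} (hα : α ≠ 0) (hL : 0 < L) (ht : 0 < t)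
    (s : Finset ℕ) (k : ℕ → ℝ) :
    t ^ (1 / α) * ∑ n ∈ s, k n * (L * t ^ (-(1 / α))) ^ (1 - n * α)
      = ∑ n ∈ s, k n * L ^ (1 - n * α) * t ^ n := by
  rw [Finset.mul_sum]
  refine Finset.sum_congr rfl fun n _ => ?_
  rw [mul_left_comm, rpow_one_div_mul_rpow_scale hα hL ht, mul_assoc]

lemma StableProcess.exists_abs_toReal_heat_sub_le (hα : α ≠ 0) {E : ℝ → ℝ} {K : ℝ} {m : ℕ}
    (hE : ∀ c, 0 < c → |stableProfile α c - E c| ≤ K * c ^ (1 - m * α)) (hab : a < b) :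
    ∃ C : ℝ, 0 < C ∧ ∀ Y : StableProcess.{u} α, ∀ t : ℝ≥0, 0 < t →
      |(Y.heat (Ioo a b) (Ioo a b)ᶜ t).toReal
          - 2 / π * ((t : ℝ) ^ (1 / α) * E ((b - a) * (t : ℝ) ^ (-(1 / α))))|
        ≤ C * (t : ℝ) ^ m := by
  refine ⟨max (2 / π * (K * (b - a) ^ (1 - m * α))) 1, by positivity, fun Y t ht => ?_⟩
  have ht' : (0 : ℝ) < t := ht
  have hL : 0 < b - a := sub_pos.2 hab
  set c := (b - a) * (t : ℝ) ^ (-(1 / α)) with hc_def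
  have hc : 0 < c := mul_pos hL (rpow_pos_of_pos ht' _)
  have hscale : 0 ≤ 2 / π * (t : ℝ) ^ (1 / α) := by positivity
  rw [Y.toReal_heat_Ioo_compl_eq_stableProfile hα hab ht]
  calc |2 / π * ((t : ℝ) ^ (1 / α) * stableProfile α c) - 2 / π * ((t : ℝ) ^ (1 / α) * E c)|
      = 2 / π * (t : ℝ) ^ (1 / α) * |stableProfile α c - E c| := by
        rw [← mul_assoc, ← mul_assoc, ← mul_sub, abs_mul, abs_of_nonneg hscale]
    _ ≤ 2 / π * (t : ℝ) ^ (1 / α) * (K * c ^ (1 - m * α)) := by gcongr; exact hE c hc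
    _ = 2 / π * (K * (b - a) ^ (1 - m * α)) * (t : ℝ) ^ m := by
        rw [mul_assoc, mul_left_comm _ K, hc_def, rpow_one_div_mul_rpow_scale hα hL ht']
        ring
    _ ≤ max (2 / π * (K * (b - a) ^ (1 - m * α))) 1 * (t : ℝ) ^ m := by
        gcongr
        exact le_max_left _ _

lemma StableProcess.exists_abs_toReal_heat_sub_sum_le (hα : 0 < α) (hα2 : α < 2)
    (hk : ∀ k : ℕ, 1 / α ≠ k) (hab : a < b) :
    ∃ C : ℝ, 0 < C ∧ ∀ Y : StableProcess.{u} α, ∀ t : ℝ≥0, 0 < t →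
      |(Y.heat (Ioo a b) (Ioo a b)ᶜ t).toReal
          - (2 / π * ∑ n ∈ Finset.Icc 1 ⌊1 / α⌋₊,
                stableCoeff α n * (b - a) ^ (1 - n * α) * (t : ℝ) ^ n
              + 2 / π * Gamma (1 - 1 / α) * (t : ℝ) ^ (1 / α))|
        ≤ C * (t : ℝ) ^ (⌊1 / α⌋₊ + 1) := by
  set N := ⌊1 / α⌋₊
  have h0 : N * α < 1 := (lt_div_iff₀ hα).1 ((Nat.floor_le (by positivity)).lt_of_ne' (hk N))
  have h1 : 1 < (N + 1 : ℕ) * α := by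
    rw [← div_lt_iff₀ hα]
    exact_mod_cast Nat.lt_floor_add_one (1 / α)
  have h2 : (N + 1 : ℕ) * α < 2 := by
    rcases Nat.eq_zero_or_pos N with hN | hN
    · simpa [hN] using hα2
    · have : 1 * α ≤ N * α := by gcongr; exact_mod_cast hN
      push_cast
      linarith
  obtain ⟨K, hK⟩ := exists_abs_stableProfile_sub_le hα h0 h1 h2
  obtain ⟨C, hC, h⟩ := exists_abs_toReal_heat_sub_le hα.ne' hK hab
  refine ⟨C, hC, fun Y t ht => ?_⟩
  have ht' : (0 : ℝ) < t := ht
  have hheat := h Y t ht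
  rw [mul_add, rpow_one_div_mul_sum_rpow_scale hα.ne' (sub_pos.2 hab) ht'] at hheat
  convert hheat using 3
  ring

lemma StableProcess.exists_abs_toReal_heat_sub_log_le {N : ℕ} (hα : (N + 1 : ℕ) * α = 1)
    (hα1 : α < 1) (hab : a < b) :
    ∃ CΩ C : ℝ, 0 < C ∧ ∀ Y : StableProcess.{u} α, ∀ t : ℝ≥0, 0 < t →
      |(Y.heat (Ioo a b) (Ioo a b)ᶜ t).toReal
          - (2 / π * ∑ n ∈ Finset.Icc 1 N,
                stableCoeff α n * (b - a) ^ (1 - n * α) * (t : ℝ) ^ n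
              + (-1) ^ N * (2 / (π * (N.factorial : ℝ))) * (t : ℝ) ^ (N + 1) * log (1 / t)
              + CΩ * (t : ℝ) ^ (N + 1))|
        ≤ C * (t : ℝ) ^ (N + 2) := by
  have hα0 : 0 < α := pos_of_succ_mul_eq_one hα
  obtain ⟨I, K, hK⟩ := exists_abs_stableProfile_sub_le_of_resonant hα hα1
  obtain ⟨C, hC, h⟩ := exists_abs_toReal_heat_sub_le hα0.ne' hK hab
  refine ⟨2 / π * ((-1) ^ N / ((N + 1).factorial : ℝ) * log (b - a) + I), C, hC,
    fun Y t ht => ?_⟩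
  have ht' : (0 : ℝ) < t := ht
  have hinv : 1 / α = (N + 1 : ℕ) := (div_eq_iff hα0.ne').2 hα.symm
  have hpow : (t : ℝ) ^ (1 / α) = (t : ℝ) ^ (N + 1) := by rw [hinv, rpow_natCast]
  have hlog : log ((b - a) * (t : ℝ) ^ (-(1 / α))) = log (b - a) + (N + 1) * log (1 / t) := by
    rw [log_mul (sub_pos.2 hab).ne' (by positivity), log_rpow ht', hinv, one_div, log_inv]
    push_cast
    ring
  have hcoeff : 2 / π * ((-1) ^ N / ((N + 1).factorial : ℝ) * (N + 1))
      = (-1) ^ N * (2 / (π * (N.factorial : ℝ))) := by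
    rw [Nat.factorial_succ]
    push_cast
    field_simp
  have hheat := h Y t ht
  rw [mul_add, rpow_one_div_mul_sum_rpow_scale hα0.ne' (sub_pos.2 hab) ht', hlog, hpow] at hheat
  convert hheat using 3
  linear_combination (-(t : ℝ) ^ (N + 1) * log (1 / t)) * hcoeff

end HeatExpansion

section Gaussian

lemma abs_min_abs_sub_abs_le_pow_div {L : ℝ} (hL : 0 < L) (y : ℝ) (n : ℕ) :
    |(min |y| L - |y|)| ≤ |y| ^ (n + 1) / L ^ n := by
  rcases le_total |y| L with h | h
  · rw [min_eq_left h, sub_self, abs_zero]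
    positivity
  · rw [min_eq_right h, abs_sub_comm, abs_of_nonneg (sub_nonneg.2 h), le_div_iff₀ (by positivity)]
    calc (|y| - L) * L ^ n ≤ |y| * |y| ^ n := by gcongr; linarith
      _ = |y| ^ (n + 1) := (pow_succ' _ _).symm

lemma abs_integral_min_abs_sub_le {μ : Measure ℝ} {L : ℝ} {n : ℕ} (hL : 0 < L)
    (h1 : Integrable (fun y => |y|) μ) (hn : Integrable (fun y => |y| ^ (n + 1)) μ) :
    |∫ y, min |y| L ∂μ - ∫ y, |y| ∂μ| ≤ (∫ y, |y| ^ (n + 1) ∂μ) / L ^ n := by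
  have hmin : Integrable (fun y : ℝ => min |y| L) μ :=
    h1.mono' (by fun_prop) (Eventually.of_forall fun y => by
      rw [norm_of_nonneg (le_min (abs_nonneg _) hL.le)]
      exact min_le_left _ _)
  rw [← integral_sub hmin h1, ← integral_div, ← norm_eq_abs]
  exact norm_integral_le_of_norm_le (hn.div_const _)
    (Eventually.of_forall fun y => abs_min_abs_sub_abs_le_pow_div hL y n)

lemma integral_abs_rpow_gaussianReal {v : ℝ≥0} (hv : v ≠ 0) {q : ℝ} (hq : -1 < q) :
    ∫ y, |y| ^ q ∂gaussianReal 0 v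
      = (√(2 * π * v))⁻¹ * ((1 / (2 * v : ℝ)) ^ (-(q + 1) / 2) * Gamma ((q + 1) / 2)) := by
  let f : ℝ → ℝ := fun y => (√(2 * π * v))⁻¹ * (y ^ q * exp (-(1 / (2 * v : ℝ)) * y ^ (2 : ℝ)))
  have hf : ∀ y : ℝ, gaussianPDFReal 0 v y • |y| ^ q = f |y| := by
    intro y
    simp only [f, gaussianPDFReal, smul_eq_mul, rpow_two, sq_abs, sub_zero]
    rw [show -y ^ 2 / (2 * (v : ℝ)) = -(1 / (2 * (v : ℝ))) * y ^ 2 by ring]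
    ring
  rw [integral_gaussianReal_eq_integral_smul hv, integral_congr_ae (Eventually.of_forall hf),
    integral_comp_abs, integral_const_mul,
    integral_rpow_mul_exp_neg_mul_rpow two_pos hq (by positivity)]
  ring

lemma integrable_abs_pow_gaussianReal (v : ℝ≥0) (n : ℕ) :
    Integrable (fun y : ℝ => |y| ^ n) (gaussianReal 0 v) := by
  simpa using (memLp_id_gaussianReal (μ := 0) (v := v) n).integrable_norm_pow'

lemma integral_abs_pow_gaussianReal_two_mul {t : ℝ≥0} (ht : 0 < t) (n : ℕ) :
    ∫ y, |y| ^ n ∂gaussianReal 0 (2 * t)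
      = 2 ^ n / √π * Gamma ((n + 1) / 2) * (t : ℝ) ^ (n / 2 : ℝ) := by
  have ht' : (0 : ℝ) < t := ht
  have hsqrt : √(2 * π * (2 * t : ℝ≥0)) = 2 * √π * √t := by
    push_cast
    rw [show 2 * π * (2 * (t : ℝ)) = 2 ^ 2 * π * t by ring, sqrt_mul (by positivity),
      sqrt_mul (by positivity), sqrt_sq zero_le_two]
  have hpow : (1 / (2 * (2 * t : ℝ≥0) : ℝ)) ^ (-(n + 1) / 2 : ℝ)
      = 2 ^ (n + 1) * ((t : ℝ) ^ (n / 2 : ℝ) * √t) := by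
    push_cast
    have hbase : 1 / (2 * (2 * (t : ℝ))) = ((2 : ℝ) ^ (2 : ℝ) * t)⁻¹ := by
      rw [rpow_two]
      ring
    rw [hbase, inv_rpow (by positivity), ← rpow_neg (by positivity),
      mul_rpow (by positivity) ht'.le, ← rpow_mul zero_le_two, sqrt_eq_rpow, ← rpow_add ht',
      ← rpow_natCast 2]
    push_cast
    congr 2 <;> ring
  have hmoment := integral_abs_rpow_gaussianReal (v := 2 * t) (by positivity) (q := n)
    (by linarith [n.cast_nonneg (α := ℝ)])
  simp only [rpow_natCast] at hmoment
  rw [hmoment, hsqrt, hpow]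
  field_simp
  ring

end Gaussian

namespace StableProcess

variable (Y : StableProcess.{u} 2)

lemma incrementLaw_eq_gaussianReal (t : ℝ≥0) : Y.incrementLaw t = gaussianReal 0 (2 * t) := by
  refine Measure.ext_of_charFun (funext fun ξ => ?_)
  rw [Y.charFun_incrementLaw, charFun_gaussianReal, rpow_two, sq_abs]
  push_cast
  congr 1
  ring

lemma abs_toReal_heat_Ioo_compl_sub_le_of_eq_two {a b : ℝ} (hab : a < b) {t : ℝ≥0} (ht : 0 < t) :
    |(Y.heat (Ioo a b) (Ioo a b)ᶜ t).toReal - 2 / √π * (t : ℝ) ^ (1 / 2 : ℝ)|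
      ≤ 8 / √π / (b - a) ^ 2 * (t : ℝ) ^ (3 / 2 : ℝ) := by
  have hfirst : ∫ y, |y| ∂gaussianReal 0 (2 * t) = 2 / √π * (t : ℝ) ^ (1 / 2 : ℝ) := by
    simpa using integral_abs_pow_gaussianReal_two_mul ht 1
  have hthird : ∫ y, |y| ^ 3 ∂gaussianReal 0 (2 * t) = 8 / √π * (t : ℝ) ^ (3 / 2 : ℝ) := by
    have hGamma : Gamma ((3 + 1) / 2) = 1 := by norm_num
    have hmoment := integral_abs_pow_gaussianReal_two_mul ht 3
    push_cast at hmoment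
    rw [hmoment, hGamma]
    norm_num
  rw [Y.toReal_heat_Ioo_compl hab, Y.incrementLaw_eq_gaussianReal, ← hfirst,
    div_mul_eq_mul_div, ← hthird]
  exact abs_integral_min_abs_sub_le (sub_pos.2 hab)
    (by simpa using integrable_abs_pow_gaussianReal (2 * t) 1)
    (integrable_abs_pow_gaussianReal (2 * t) 3)

variable {α a b : ℝ}

lemma exists_abs_toReal_heat_sub_gamma_le (h1 : 1 < α) (h2 : α < 2) (hab : a < b) :
    ∃ C : ℝ, 0 < C ∧ ∀ Y : StableProcess.{u} α, ∀ t : ℝ≥0, 0 < t →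
      |(Y.heat (Ioo a b) (Ioo a b)ᶜ t).toReal - 2 / π * Gamma (1 - 1 / α) * (t : ℝ) ^ (1 / α)|
        ≤ C * t := by
  have hα : 0 < α := one_pos.trans h1
  have hlt : 1 / α < 1 := (div_lt_one hα).2 h1
  have hk (k : ℕ) : 1 / α ≠ k := fun hk => by
    have hpos : 0 < 1 / α := by positivity
    rw [hk] at hlt hpos
    norm_cast at hlt hpos
    omega
  have hfloor : ⌊1 / α⌋₊ = 0 := Nat.floor_eq_zero.2 hlt
  simpa [hfloor, -one_div] using exists_abs_toReal_heat_sub_sum_le hα h2 hk hab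

lemma exists_abs_toReal_heat_sub_gamma_le_indicator (h1 : 1 < α) (h2 : α ≤ 2) (hab : a < b) :
    ∃ C : ℝ, 0 < C ∧ ∀ Y : StableProcess.{u} α, ∀ t : ℝ≥0, 0 < t →
      |(Y.heat (Ioo a b) (Ioo a b)ᶜ t).toReal - 2 / π * Gamma (1 - 1 / α) * (t : ℝ) ^ (1 / α)|
        ≤ C * ((t : ℝ) * indicator (Ioo (1 : ℝ) 2) 1 α
            + (t : ℝ) ^ (3 / 2 : ℝ) * indicator ({2} : Set ℝ) 1 α) := by
  rcases h2.lt_or_eq with h2 | rfl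
  · simpa [h1, h2, h2.ne] using exists_abs_toReal_heat_sub_gamma_le h1 h2 hab
  · have : 0 < b - a := sub_pos.2 hab
    have hGamma : 2 / π * Gamma (1 - 2⁻¹) = 2 / √π := by
      rw [← one_div, sub_half, Gamma_one_half_eq, div_mul_eq_mul_div, mul_div_assoc, sqrt_div_self']
      ring
    refine ⟨8 / √π / (b - a) ^ 2, by positivity, fun Y t ht => ?_⟩
    simpa [hGamma] using Y.abs_toReal_heat_Ioo_compl_sub_le_of_eq_two hab ht

lemma exists_abs_toReal_heat_sub_log_le_of_one_div {N : ℕ} (hN : 2 ≤ N) (hab : a < b) :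
    ∃ CΩ C : ℝ, 0 < C ∧ ∀ Y : StableProcess.{u} (1 / (N : ℝ)), ∀ t : ℝ≥0, 0 < t →
      |(Y.heat (Ioo a b) (Ioo a b)ᶜ t).toReal
          - (2 / π * ∑ n ∈ Finset.Icc 1 (N - 1),
                stableCoeff (1 / N) n * (b - a) ^ (1 - n * (1 / N) : ℝ) * (t : ℝ) ^ n
              + (-1) ^ (N - 1) * (2 / (π * ((N - 1).factorial : ℝ))) * (t : ℝ) ^ N * log (1 / t)
              + CΩ * (t : ℝ) ^ N)|
        ≤ C * (t : ℝ) ^ (N + 1) := by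
  obtain ⟨N, rfl⟩ : ∃ M, N = M + 1 := ⟨N - 1, by omega⟩
  exact exists_abs_toReal_heat_sub_log_le (mul_one_div_cancel (by positivity))
    ((div_lt_one (by positivity)).2 (by exact_mod_cast hN)) hab

end StableProcess

lemma stableCoeff_mul_mul (α y z : ℝ) (n : ℕ) :
    stableCoeff α n * y * z
      = (-1) ^ (n - 1) * (Gamma (n * α) / ((1 - n * α) * (n.factorial : ℝ))) * y
        * sin (π * n * α / 2) * z := by
  rw [stableCoeff, mul_right_comm _ (sin _)]

theorem mainTheorem3_general :
    (∀ α : ℝ, 1 < α → α ≤ 2 → ∀ a b : ℝ, a < b →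
      ∃ C : ℝ, 0 < C ∧ ∀ Y : StableProcess.{u} α, ∀ t : ℝ≥0, 0 < t →
        |(Y.heat (Ioo a b) (Ioo a b)ᶜ t).toReal - 2 / π * Gamma (1 - 1 / α) * (t : ℝ) ^ (1 / α)|
          ≤ C * ((t : ℝ) * indicator (Ioo (1 : ℝ) 2) 1 α
              + (t : ℝ) ^ (3 / 2 : ℝ) * indicator ({2} : Set ℝ) 1 α)) ∧
    (∀ a b : ℝ, a < b → ∀ Y : StableProcess.{u} 1, ∀ t : ℝ≥0, 0 < t →
      (Y.heat (Ioo a b) (Ioo a b)ᶜ t).toReal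
        = 2 / π * t * log (1 / t)
          + 2 / π * ((b - a) * arctan (t / (b - a))
              + 1 / 2 * t * log ((t : ℝ) ^ 2 + (b - a) ^ 2))) ∧
    (∀ α : ℝ, 0 < α → α < 2 → (∀ k : ℕ, 1 / α ≠ k) → ∀ a b : ℝ, a < b →
      ∃ C : ℝ, 0 < C ∧ ∀ Y : StableProcess.{u} α, ∀ t : ℝ≥0, 0 < t →
        |(Y.heat (Ioo a b) (Ioo a b)ᶜ t).toReal
            - (2 / π * ∑ n ∈ Finset.Icc 1 ⌊1 / α⌋₊,
                  (-1 : ℝ) ^ (n - 1)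
                    * (Gamma (n * α) / ((1 - n * α) * (n.factorial : ℝ)))
                    * (b - a) ^ (1 - n * α) * sin (π * n * α / 2) * (t : ℝ) ^ n
                + 2 / π * Gamma (1 - 1 / α) * (t : ℝ) ^ (1 / α))|
          ≤ C * (t : ℝ) ^ (⌊1 / α⌋₊ + 1)) ∧
    (∀ N : ℕ, 2 ≤ N → ∀ a b : ℝ, a < b →
      ∃ CN : ℝ, ∃ C : ℝ, 0 < C ∧ ∀ Y : StableProcess.{u} (1 / (N : ℝ)), ∀ t : ℝ≥0, 0 < t →
        |(Y.heat (Ioo a b) (Ioo a b)ᶜ t).toReal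
            - (2 / π * ∑ n ∈ Finset.Icc 1 (N - 1),
                  (-1 : ℝ) ^ (n - 1)
                    * (Gamma (n / N) / ((1 - (n : ℝ) / N) * (n.factorial : ℝ)))
                    * (b - a) ^ (1 - (n : ℝ) / N) * sin (π * n / (2 * N)) * (t : ℝ) ^ n
                + (-1 : ℝ) ^ (N - 1) * (2 / (π * ((N - 1).factorial : ℝ)))
                    * (t : ℝ) ^ N * log (1 / t)
                + CN * (t : ℝ) ^ N)|
          ≤ C * (t : ℝ) ^ (N + 1)) := by
  refine ⟨fun α h1 h2 a b hab =>
      StableProcess.exists_abs_toReal_heat_sub_gamma_le_indicator h1 h2 hab,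
    fun a b hab Y t ht => Y.toReal_heat_Ioo_compl_of_eq_one hab ht,
    fun α hα h2 hk a b hab => ?_, fun N hN a b hab => ?_⟩
  · simpa only [stableCoeff_mul_mul]
      using StableProcess.exists_abs_toReal_heat_sub_sum_le hα h2 hk hab
  · have hN2 (n : ℕ) : π * n / N / 2 = π * n / (2 * N) := by ring
    simpa only [stableCoeff_mul_mul, hN2, mul_one_div]
      using StableProcess.exists_abs_toReal_heat_sub_log_le_of_one_div hN hab

end

theorem mainTheorem3 :
    -- the case `1 < α ≤ 2`
    (∀ α : ℝ, 1 < α → α ≤ 2 → ∀ a b : ℝ, a < b →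
      ∃ C : ℝ, 0 < C ∧ ∀ Y : StableProcess.{u} α, ∀ t : ℝ≥0, 0 < t →
        |(Y.heat (Set.Ioo a b) (Set.Ioo a b)ᶜ t).toReal
            - 2 / Real.pi * Real.Gamma (1 - 1 / α) * (t : ℝ) ^ (1 / α)|
          ≤ C * ((t : ℝ) * Set.indicator (Set.Ioo (1 : ℝ) 2) 1 α
              + (t : ℝ) ^ (3 / 2 : ℝ) * Set.indicator ({2} : Set ℝ) 1 α)) ∧
    -- the case `α = 1`
    (∀ a b : ℝ, a < b → ∀ Y : StableProcess.{u} 1, ∀ t : ℝ≥0, 0 < t →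
      (Y.heat (Set.Ioo a b) (Set.Ioo a b)ᶜ t).toReal
        = 2 / Real.pi * t * Real.log (1 / t)
          + 2 / Real.pi * ((b - a) * Real.arctan (t / (b - a))
              + 1 / 2 * t * Real.log ((t : ℝ) ^ 2 + (b - a) ^ 2))) ∧
    -- the case `0 < α < 1` with `1 / α` not an integer
    (∀ α : ℝ, 0 < α → α < 1 → (∀ k : ℕ, 1 / α ≠ k) →
      ∃ Cα : ℝ, ∀ a b : ℝ, a < b →
        ∃ C : ℝ, 0 < C ∧ ∀ Y : StableProcess.{u} α, ∀ t : ℝ≥0, 0 < t →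
          (t : ℝ) < min ((b - a) ^ α) (Real.exp (-1)) →
          |(Y.heat (Set.Ioo a b) (Set.Ioo a b)ᶜ t).toReal
              - (2 / Real.pi * ∑ n ∈ Finset.Icc 1 ⌊1 / α⌋₊,
                    (-1 : ℝ) ^ (n - 1)
                      * (Real.Gamma (n * α) / ((1 - n * α) * (n.factorial : ℝ)))
                      * (b - a) ^ (1 - n * α) * Real.sin (Real.pi * n * α / 2) * (t : ℝ) ^ n
                  + Cα * (t : ℝ) ^ (1 / α))|
            ≤ C * (t : ℝ) ^ (⌊1 / α⌋₊ + 1)) ∧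
    -- the case `0 < α < 1` with `α = 1 / N`
    (∀ N : ℕ, 2 ≤ N → ∀ a b : ℝ, a < b →
      ∃ CN : ℝ, ∃ C : ℝ, 0 < C ∧ ∀ Y : StableProcess.{u} (1 / (N : ℝ)), ∀ t : ℝ≥0, 0 < t →
        (t : ℝ) < min ((b - a) ^ (1 / (N : ℝ))) (Real.exp (-1)) →
        |(Y.heat (Set.Ioo a b) (Set.Ioo a b)ᶜ t).toReal
            - (2 / Real.pi * ∑ n ∈ Finset.Icc 1 (N - 1),
                  (-1 : ℝ) ^ (n - 1)
                    * (Real.Gamma (n / N) / ((1 - (n : ℝ) / N) * (n.factorial : ℝ)))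
                    * (b - a) ^ (1 - (n : ℝ) / N) * Real.sin (Real.pi * n / (2 * N)) * (t : ℝ) ^ n
                + (-1 : ℝ) ^ (N - 1) * (2 / (Real.pi * ((N - 1).factorial : ℝ)))
                    * (t : ℝ) ^ N * Real.log (1 / t)
                + CN * (t : ℝ) ^ N)|
          ≤ C * (t : ℝ) ^ (N + 1)) := by
  obtain ⟨hsup, hone, hsub, hres⟩ := mainTheorem3_general.{u}
  refine ⟨hsup, hone, fun α hα h1 hk => ⟨2 / Real.pi * Real.Gamma (1 - 1 / α), fun a b hab => ?_⟩,
    fun N hN a b hab => ?_⟩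
  · obtain ⟨C, hC, hheat⟩ := hsub α hα (by linarith) hk a b hab
    exact ⟨C, hC, fun Y t ht _ => hheat Y t ht⟩
  · obtain ⟨CN, C, hC, hheat⟩ := hres N hN a b hab
    exact ⟨CN, C, hC, fun Y t ht _ => hheat Y t ht⟩
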